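/- Let $\mathbb K\in\{\mathbb R,\mathbb C\}$. Smoothness of maps between open subsets of Hausdorff locally convex $\mathbb K$-spaces is understood in the sense of Michal–Bastiani: $f$ is $C^1$ if it is continuous, all directional derivatives $df(x)(h)=\lim_{t\to 0}t^{-1}(f(x+th)-f(x))$ exist and $(x,h)\mapsto df(x)(h)$ is continuous; $f$ is $C^{n}$ if it is $C^1$ and $df$ is $C^{n-1}$; smooth means $C^n$ for all $n$. A Lie group is a group that is a smooth manifold modelled on a Hausdorff locally convex space with smooth multiplication and inversion. Let $G$ and $N$ be Lie groups, $Z(N)$ the center of $N$, $\mathrm{Aut}(N)$ the group of Lie group automorphisms of $N$, and $C_N(n)(x)=nxn^{-1}$. **Cochains.** $C^p_s(G,N)$ is the set of maps $f:G^p\to N$ that are smooth on a neighborhood of the identity and normalized ($f=\mathbf 1$ whenever one argument is $\mathbf 1$). $C^2_{ss}(G,N)$ is the set of those $\omega\in C^2_s(G,N)$ for which, for every $g\in G$, the map $x\mapsto \omega(g,x)\,\omega(gxg^{-1},g)^{-1}$ is smooth on an identity neighborhood of $G$. $C^p_s(G,Z(N))$ and $C^2_{ss}(G,Z(N))$ are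 the groups of the elements of $C^p_s(G,N)$, resp. $C^2_{ss}(G,N)$, with values in $Z(N)$. $C^1_s(G,\mathrm{Aut}(N))$ is the set of maps $S:G\to\mathrm{Aut}(N)$ with $S(\mathbf 1)=\mathrm{id}_N$ such that $(g,n)\mapsto S(g)(n)$ is smooth on $U\times N$ for some open identity neighborhood $U\subseteq G$. **Outer actions.** A smooth outer action of $G$ on $N$ is an $S\in C^1_s(G,\mathrm{Aut}(N))$ for which there is an $\omega\in C^2_s(G,N)$ with $S(g)S(g')S(gg')^{-1}=C_N(\omega(g,g'))$ for all $g,g'\in G$; it is strongly smooth if $\omega$ can be chosen in $C^2_{ss}(G,N)$. Write $S\sim S'$ if $S'(g)=C_N(h(g))S(g)$ for all $g\in G$, for some $h\in C^1_s(G,N)$; let $[S]$ be the class of $S$ for $\sim$ (the smooth $G$-kernel of $S$). **Characteristic class.** A smooth outer action $S$ turns $Z(N)$ into a $G$-module via $g.z=S(g)(z)$; let $d_S$ be the usual inhomogeneous group differential on $Z(N)$-valued cochains, and put $Z^3_s(G,Z(N))_S=\{f\in C^3_s(G,Z(N)) : d_Sf=\mathbf 1\}$, $$H^3_{s}(G,Z(N))_S=Z^3_s(G,Z(N))_S/d_S(C^2_{s}(G,Z(N))),\qquad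 H^3_{ss}(G,Z(N))_S=Z^3_s(G,Z(N))_S/d_S(C^2_{ss}(G,Z(N))),$$ the latter for strongly smooth $S$. For $\omega$ as in the definition of a (strongly) smooth outer action, the map $$(d_S\omega)(g,g',g'')=S(g)(\omega(g',g''))\,\omega(g,g'g'')\,\omega(gg',g'')^{-1}\,\omega(g,g')^{-1}$$ lies in $Z^3_s(G,Z(N))_S$. Its class $\chi_s(S)=[d_S\omega]\in H^3_s(G,Z(N))_S$ (with $\omega\in C^2_s(G,N)$), resp. $\chi_{ss}(S)=[d_S\omega]\in H^3_{ss}(G,Z(N))_S$ (with $\omega\in C^2_{ss}(G,N)$, for strongly smooth $S$), does not depend on the choice of $\omega$. **Extensions.** A Lie group extension of $G$ by $N$ is a short exact sequence of Lie group morphisms $\mathbf 1\to N\xrightarrow{\iota}\widehat G\xrightarrow{q}G\to\mathbf 1$ such that $q$ is a locally trivial smooth principal bundle for the right action of $N$ on $\widehat G$ through $\iota$. Two extensions are equivalent if there is a Lie group morphism between them that induces the identity on $N$ and on $G$. An extension corresponds to $[S]$ if, for a section $\sigma:G\to\widehat G$ of $q$ with $\sigma(\mathbf 1)=\mathbf 1$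 that is smooth on an identity neighborhood, the map $S'$ given by $\iota(S'(g)(n))=\sigma(g)\iota(n)\sigma(g)^{-1}$ satisfies $S'\sim S$. Let $\mathrm{Ext}(G,N)_{[S]}$ be the set of equivalence classes of Lie group extensions of $G$ by $N$ corresponding to $[S]$. **Theorem.** (1) If $S$ is a strongly smooth outer action of $G$ on $N$, then $$\chi_{ss}(S)=\mathbf 1\iff \mathrm{Ext}(G,N)_{[S]}\neq\emptyset .$$ (2) If $G$ is connected and $S$ is a smooth outer action of $G$ on $N$, then $$\chi_{s}(S)=\mathbf 1\iff \mathrm{Ext}(G,N)_{[S]}\neq\emptyset .$$ -/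

import Mathlib

universe u v w
open Set Filter Topology

/-- The directional derivative `df(x)(h) = lim_{t → 0} t⁻¹ (f (x + t h) - f x)` exists and
equals `y`. -/
def HasDirDerivAt (𝕜 : Type*) [RCLike 𝕜] {X Y : Type*} [AddCommGroup X] [Module 𝕜 X]
    [AddCommGroup Y] [Module 𝕜 Y] [TopologicalSpace Y] (f : X → Y) (x h : X) (y : Y) : Prop :=
  Tendsto (fun t : 𝕜 => t⁻¹ • (f (x + t • h) - f x)) (𝓝[≠] 0) (𝓝 y)

/-- `f` is `C^n` on the open set `U`: for `n = 0` it is continuous; for `n + 1` it is continuous,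
all directional derivatives exist at the points of `U`, and `(x, h) ↦ df(x)(h)` is `C^n` on
`U × X`. (For `n = 1` this says that `df` is continuous on `U × X`.) -/
def IsCk (𝕜 : Type*) [RCLike 𝕜] {Y : Type v} [AddCommGroup Y] [Module 𝕜 Y] [TopologicalSpace Y]
    (n : ℕ) {X : Type u} [AddCommGroup X] [Module 𝕜 X] [TopologicalSpace X]
    (f : X → Y) (U : Set X) : Prop :=
  match n with
  | 0 => ContinuousOn f U
  | n + 1 => ContinuousOn f U ∧ ∃ df : X × X → Y,
      (∀ x ∈ U, ∀ h, HasDirDerivAt 𝕜 f x h (df (x, h))) ∧ IsCk 𝕜 n df (U ×ˢ univ)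

section Calculus

variable {𝕜 : Type*} [RCLike 𝕜]
  {X : Type u} [AddCommGroup X] [Module 𝕜 X] [TopologicalSpace X]
  {Y : Type v} [AddCommGroup Y] [Module 𝕜 Y] [TopologicalSpace Y]
  {Z : Type w} [AddCommGroup Z] [Module 𝕜 Z] [TopologicalSpace Z]

theorem seminorm_sub_le_of_deriv [PolynormableSpace 𝕜 Z] {p : Seminorm 𝕜 Z} (hp : Continuous p)
    {γ γ' : ℝ → Z} {c : Z} {ε : ℝ}
    (hγ : ∀ s ∈ Icc (0 : ℝ) 1,
      Tendsto (fun r : ℝ => (r : 𝕜)⁻¹ • (γ (s + r) - γ s)) (𝓝[≠] 0) (𝓝 (γ' s)))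
    (hb : ∀ s ∈ Icc (0 : ℝ) 1, p (γ' s - c) ≤ ε) : p (γ 1 - γ 0 - c) ≤ ε := by
  set x₀ := γ 1 - γ 0 - c with hx₀
  obtain ⟨f, hf1, hf2⟩ : ∃ f : StrongDual 𝕜 Z, ‖f x₀‖ = p x₀ ∧ ∀ x, ‖f x‖ ≤ p x := by
    by_cases hx : x₀ = 0
    · exact ⟨0, by simp [hx], fun x => by simp⟩
    · obtain ⟨f, h1, h2⟩ := Module.Dual.exists_continuous_extension_of_le_seminorm
        (Submodule.span 𝕜 {x₀})
        (((p x₀ : ℝ) : 𝕜) • (LinearEquiv.toSpanNonzeroSingleton 𝕜 Z x₀ hx).symm.toLinearMap)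
        (p := p) hp (by
          rintro ⟨x, hxm⟩
          obtain ⟨a, rfl⟩ := Submodule.mem_span_singleton.1 hxm
          have : (⟨a • x₀, hxm⟩ : Submodule.span 𝕜 {x₀}) =
            LinearEquiv.toSpanNonzeroSingleton 𝕜 Z x₀ hx a := by
              ext; simp
          simp only [this, LinearMap.smul_apply, LinearEquiv.coe_coe, LinearEquiv.symm_apply_apply]
          simp [map_smul_eq_mul, mul_comm, abs_of_nonneg (apply_nonneg p x₀)])
      refine ⟨f, ?_, h2⟩
      have := h1 ⟨x₀, Submodule.mem_span_singleton_self x₀⟩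
      rw [← LinearEquiv.toSpanNonzeroSingleton_one 𝕜 Z x₀ hx] at this
      simp only [LinearMap.smul_apply, LinearEquiv.coe_coe, LinearEquiv.symm_apply_apply] at this
      simp at this
      rw [this]
      simp
  have key := norm_image_sub_le_of_norm_deriv_le_segment_01'
    (f := fun s : ℝ => f (γ s) - (s : 𝕜) * f c) (f' := fun s => f (γ' s) - f c) (C := ε) ?_ ?_
  · simp only [RCLike.ofReal_one, one_mul, RCLike.ofReal_zero, zero_mul, sub_zero] at key
    rw [← hf1, hx₀, map_sub]
    have e : f (γ 1) - f c - f (γ 0) = f (γ 1) - f (γ 0) - f c := by ring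
    rw [map_sub, ← e]
    exact key
  · intro s hs
    apply HasDerivAt.hasDerivWithinAt
    rw [hasDerivAt_iff_tendsto_slope_zero]
    have h := ((f.continuous.tendsto _).comp (hγ s hs)).sub_const (f c)
    refine h.congr' ?_
    filter_upwards [self_mem_nhdsWithin] with r hr
    have hr' : (r : 𝕜) ≠ 0 := by simpa using hr
    simp only [Function.comp, map_smul, map_sub, smul_eq_mul, RCLike.ofReal_add,
      RCLike.real_smul_eq_coe_mul, RCLike.ofReal_inv]
    field_simp
    ring
  · intro s hs
    rw [← map_sub]
    exact (hf2 _).trans (hb s ⟨hs.1, hs.2.le⟩)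

theorem HasDirDerivAt.comp [IsTopologicalAddGroup Y] [ContinuousSMul 𝕜 Y]
    [PolynormableSpace 𝕜 Z] {f : X → Y} {g : Y → Z} {dg : Y × Y → Z} {V : Set Y} {x h : X} {k : Y}
    (hV : IsOpen V) (hx : f x ∈ V) (hf : HasDirDerivAt 𝕜 f x h k)
    (hg : ∀ y ∈ V, ∀ k, HasDirDerivAt 𝕜 g y k (dg (y, k)))
    (hc : ContinuousOn dg (V ×ˢ univ)) : HasDirDerivAt 𝕜 (g ∘ f) x h (dg (f x, k)) := by
  have hp := PolynormableSpace.withSeminorms 𝕜 Z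
  unfold HasDirDerivAt
  rw [hp.tendsto_nhds]
  rintro ⟨p, hpc⟩ ε hε
  have hca : ContinuousAt dg (f x, k) :=
    hc.continuousAt ((hV.prod isOpen_univ).mem_nhds ⟨hx, mem_univ _⟩)
  have h1 : ∀ᶠ q in 𝓝 (f x, k), q.1 ∈ V ∧ p (dg q - dg (f x, k)) ≤ ε / 2 := by
    refine (continuous_fst.continuousAt.eventually (hV.mem_nhds hx)).and ?_
    have := hp.tendsto_nhds dg (f := 𝓝 (f x, k)) (dg (f x, k))
    filter_upwards [this.1 hca ⟨p, hpc⟩ (ε / 2) (by positivity)] with q hq using hq.le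
  have hm : Tendsto (fun q : 𝕜 × Y => (f x + q.1 • q.2, q.2)) (𝓝 ((0 : 𝕜), k)) (𝓝 (f x, k)) := by
    have : Continuous (fun q : 𝕜 × Y => (f x + q.1 • q.2, q.2)) := by fun_prop
    simpa using this.tendsto ((0 : 𝕜), k)
  have h2 := hm.eventually h1
  rw [nhds_prod_eq, eventually_prod_iff] at h2
  obtain ⟨pa, hpa, pb, hpb, hab⟩ := h2
  obtain ⟨δ, hδ, hball⟩ := Metric.eventually_nhds_iff.1 hpa
  have hsm : ∀ᶠ t : 𝕜 in 𝓝[≠] 0, dist t 0 < δ :=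
    nhdsWithin_le_nhds (Metric.ball_mem_nhds _ hδ)
  filter_upwards [hf.eventually hpb, hsm, self_mem_nhdsWithin] with t ht1 ht2 ht3
  have ht0 : t ≠ 0 := ht3
  set kt := t⁻¹ • (f (x + t • h) - f x) with hkt
  have hft : f (x + t • h) = f x + t • kt := by rw [hkt, smul_inv_smul₀ ht0]; abel
  have hin : ∀ r ∈ Icc (0 : ℝ) 1, f x + ((r : 𝕜) * t) • kt ∈ V ∧
      p (dg (f x + ((r : 𝕜) * t) • kt, kt) - dg (f x, k)) ≤ ε / 2 := by
    intro r hr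
    refine hab (x := (r : 𝕜) * t) ?_ ht1
    apply hball
    rw [dist_zero_right] at ht2 ⊢
    rw [norm_mul, RCLike.norm_ofReal, abs_of_nonneg hr.1]
    exact (mul_le_of_le_one_left (norm_nonneg _) hr.2).trans_lt ht2
  have := seminorm_sub_le_of_deriv hpc (γ := fun r : ℝ => t⁻¹ • g (f x + ((r : 𝕜) * t) • kt))
    (γ' := fun r => dg (f x + ((r : 𝕜) * t) • kt, kt)) (c := dg (f x, k)) (ε := ε / 2) ?_
    (fun r hr => (hin r hr).2)
  · simp only [RCLike.ofReal_one, one_mul, RCLike.ofReal_zero, zero_mul, zero_smul, add_zero] at this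
    rw [← hft, ← smul_sub] at this
    exact this.trans_lt (by linarith)
  · intro r hr
    have hd := hg _ (hin r hr).1 kt
    have htt : Tendsto (fun r' : ℝ => (r' : 𝕜) * t) (𝓝[≠] 0) (𝓝[≠] 0) := by
      refine tendsto_nhdsWithin_iff.2 ⟨?_, ?_⟩
      · have : Continuous (fun r' : ℝ => (r' : 𝕜) * t) := by fun_prop
        simpa using (this.tendsto 0).mono_left nhdsWithin_le_nhds
      · filter_upwards [self_mem_nhdsWithin] with r' hr'
        have : (r' : 𝕜) ≠ 0 := by simpa using hr'
        simpa using ⟨by simpa using hr', ht0⟩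
    refine (Tendsto.comp hd htt).congr fun r' => ?_
    simp only [Function.comp, mul_inv, RCLike.ofReal_add, add_mul, add_smul, ← add_assoc]
    rw [← smul_sub, ← smul_smul, ← smul_smul]

theorem IsCk.continuousOn {n : ℕ} {f : X → Y} {U : Set X} (h : IsCk 𝕜 n f U) :
    ContinuousOn f U := by
  cases n with
  | zero => exact h
  | succ n => exact h.1

theorem IsCk.mono {n : ℕ} {f : X → Y} {U V : Set X} (h : IsCk 𝕜 n f U) (hV : V ⊆ U) :
    IsCk 𝕜 n f V := by
  induction n generalizing X with
  | zero => exact ContinuousOn.mono h hV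
  | succ n ih =>
    obtain ⟨hc, df, hd, hdf⟩ := h
    exact ⟨hc.mono hV, df, fun x hx => hd x (hV hx), ih hdf (prod_mono hV subset_rfl)⟩

theorem IsCk.pred {n : ℕ} {f : X → Y} {U : Set X} (h : IsCk 𝕜 (n + 1) f U) : IsCk 𝕜 n f U := by
  induction n generalizing X with
  | zero => exact h.1
  | succ n ih =>
    obtain ⟨hc, df, hd, hdf⟩ := h
    exact ⟨hc, df, hd, ih hdf⟩

theorem HasDirDerivAt.congr [IsTopologicalAddGroup X] [ContinuousSMul 𝕜 X] {f g : X → Y}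
    {U : Set X} (hU : IsOpen U) (hfg : EqOn f g U) {x h : X} {y : Y} (hx : x ∈ U)
    (hf : HasDirDerivAt 𝕜 f x h y) : HasDirDerivAt 𝕜 g x h y := by
  refine Tendsto.congr' ?_ hf
  have : Tendsto (fun t : 𝕜 => x + t • h) (𝓝[≠] 0) (𝓝 x) := by
    have : Continuous (fun t : 𝕜 => x + t • h) := by fun_prop
    simpa using (this.tendsto 0).mono_left nhdsWithin_le_nhds
  filter_upwards [this.eventually (hU.mem_nhds hx)] with t ht
  rw [hfg ht, hfg hx]

theorem IsCk.congr [IsTopologicalAddGroup X] [ContinuousSMul 𝕜 X] {n : ℕ} {f g : X → Y}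
    {U : Set X} (hU : IsOpen U) (hfg : EqOn f g U) (hf : IsCk 𝕜 n f U) : IsCk 𝕜 n g U := by
  cases n with
  | zero => exact ContinuousOn.congr hf hfg.symm
  | succ n =>
    obtain ⟨hc, df, hd, hdf⟩ := hf
    exact ⟨hc.congr hfg.symm, df, fun x hx h => (hd x hx h).congr hU hfg hx, hdf⟩

theorem IsCk.of_local [IsTopologicalAddGroup X] [ContinuousSMul 𝕜 X] [T2Space Y]
    {n : ℕ} {f : X → Y} {U : Set X}
    (h : ∀ x ∈ U, ∃ V, IsOpen V ∧ x ∈ V ∧ IsCk 𝕜 n f V) : IsCk 𝕜 n f U := by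
  induction n generalizing X with
  | zero =>
    intro x hx
    obtain ⟨V, hV, hxV, hf⟩ := h x hx
    exact (ContinuousOn.continuousAt hf (hV.mem_nhds hxV)).continuousWithinAt
  | succ n ih =>
    classical
    refine ⟨?_, fun q => if hq : ∃ y, HasDirDerivAt 𝕜 f q.1 q.2 y then hq.choose else 0, ?_, ?_⟩
    · intro x hx
      obtain ⟨V, hV, hxV, hf⟩ := h x hx
      exact (hf.1.continuousAt (hV.mem_nhds hxV)).continuousWithinAt
    · intro x hx k
      obtain ⟨V, hV, hxV, hf, df, hd, -⟩ := h x hx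
      have hq : ∃ y, HasDirDerivAt 𝕜 f x k y := ⟨_, hd x hxV k⟩
      simp only [hq, dite_true]
      exact hq.choose_spec
    · apply ih
      rintro ⟨x, k⟩ ⟨hx, -⟩
      obtain ⟨V, hV, hxV, hf, df, hd, hdf⟩ := h x hx
      refine ⟨V ×ˢ univ, hV.prod isOpen_univ, ⟨hxV, mem_univ _⟩,
        hdf.congr (hV.prod isOpen_univ) ?_⟩
      rintro ⟨x', k'⟩ ⟨hx', -⟩
      have hq : ∃ y, HasDirDerivAt 𝕜 f x' k' y := ⟨_, hd x' hx' k'⟩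
      simp only [hq, dite_true]
      exact tendsto_nhds_unique (hd x' hx' k') hq.choose_spec

theorem IsCk.prodMk {n : ℕ} {f : X → Y} {g : X → Z} {U : Set X}
    (hf : IsCk 𝕜 n f U) (hg : IsCk 𝕜 n g U) : IsCk 𝕜 n (fun x => (f x, g x)) U := by
  induction n generalizing X with
  | zero => exact ContinuousOn.prodMk hf hg
  | succ n ih =>
    obtain ⟨hc, df, hd, hdf⟩ := hf
    obtain ⟨hc', dg, hd', hdg⟩ := hg
    exact ⟨hc.prodMk hc', fun q => (df q, dg q),
      fun x hx h => (hd x hx h).prodMk_nhds (hd' x hx h), ih hdf hdg⟩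

theorem ContinuousLinearMap.isCk (n : ℕ) (L : X →L[𝕜] Y) (U : Set X) : IsCk 𝕜 n L U := by
  induction n generalizing X with
  | zero => exact L.continuous.continuousOn
  | succ n ih =>
    refine ⟨L.continuous.continuousOn, L.comp (ContinuousLinearMap.snd 𝕜 X X), fun x _ h => ?_,
      ih _ _⟩
    refine Tendsto.congr' ?_ tendsto_const_nhds
    filter_upwards [self_mem_nhdsWithin] with t ht
    simp [inv_smul_smul₀ (show t ≠ 0 from ht)]

theorem isCk_const (n : ℕ) (c : Y) (U : Set X) : IsCk 𝕜 n (fun _ : X => c) U := by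
  induction n generalizing X c with
  | zero => exact continuousOn_const
  | succ n ih =>
    refine ⟨continuousOn_const, fun _ => 0, fun x _ h => ?_, ih _ _⟩
    simpa [HasDirDerivAt] using tendsto_const_nhds

theorem IsCk.comp_clm {W : Type*} [AddCommGroup W] [Module 𝕜 W] [TopologicalSpace W]
    {n : ℕ} {f : X → Y} {U : Set X} (hf : IsCk 𝕜 n f U) (L : W →L[𝕜] X) :
    IsCk 𝕜 n (f ∘ L) (L ⁻¹' U) := by
  induction n generalizing X W with
  | zero => exact ContinuousOn.comp hf L.continuous.continuousOn fun _ h => h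
  | succ n ih =>
    obtain ⟨hc, df, hd, hdf⟩ := hf
    refine ⟨hc.comp L.continuous.continuousOn fun _ h => h, df ∘ (L.prodMap L),
      fun x hx h => ?_, ?_⟩
    · refine Tendsto.congr (fun t => ?_) (hd (L x) hx (L h))
      simp
    · exact (ih hdf (L.prodMap L)).mono fun q hq => ⟨hq.1, mem_univ _⟩

theorem IsCk.comp [IsTopologicalAddGroup X] [ContinuousSMul 𝕜 X] [IsTopologicalAddGroup Y]
    [ContinuousSMul 𝕜 Y] [PolynormableSpace 𝕜 Z] {n : ℕ} {f : X → Y} {g : Y → Z}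
    {U : Set X} {V : Set Y} (hU : IsOpen U) (hV : IsOpen V) (hUV : MapsTo f U V)
    (hg : IsCk 𝕜 n g V) (hf : IsCk 𝕜 n f U) : IsCk 𝕜 n (g ∘ f) U := by
  induction n generalizing X Y with
  | zero => exact ContinuousOn.comp hg hf hUV
  | succ n ih =>
    have hf' := hf.pred
    obtain ⟨hc, df, hd, hdf⟩ := hf
    obtain ⟨hc', dg, hd', hdg⟩ := hg
    refine ⟨hc'.comp hc hUV, dg ∘ fun q => (f q.1, df q), fun x hx h =>
      (hd x hx h).comp hV (hUV hx) hd' hdg.continuousOn, ?_⟩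
    refine ih (hU.prod isOpen_univ) (hV.prod isOpen_univ) ?_ hdg (IsCk.prodMk ?_ hdf)
    · rintro ⟨x, h⟩ ⟨hx, -⟩
      exact ⟨hUV hx, mem_univ _⟩
    · exact (hf'.comp_clm (ContinuousLinearMap.fst 𝕜 X X)).mono fun q hq => hq.1
end Calculus

section Manifolds

/-- Smooth, i.e. `C^n` for all `n`, on the open set `U`. -/
def IsSmoothOn (𝕜 : Type*) [RCLike 𝕜] {X Y : Type*} [AddCommGroup X] [Module 𝕜 X]
    [TopologicalSpace X] [AddCommGroup Y] [Module 𝕜 Y] [TopologicalSpace Y]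
    (f : X → Y) (U : Set X) : Prop :=
  ∀ n : ℕ, IsCk 𝕜 n f U

/-- The charts of the atlas modelled on `E` are smoothly compatible. -/
class IsSmoothManifold (𝕜 : Type*) [RCLike 𝕜] (E : Type*) [AddCommGroup E] [Module 𝕜 E]
    [TopologicalSpace E] (M : Type*) [TopologicalSpace M] [ChartedSpace E M] : Prop where
  compat : ∀ e ∈ atlas E M, ∀ e' ∈ atlas E M,
    IsSmoothOn 𝕜 (e' ∘ e.symm) (e.target ∩ e.symm ⁻¹' e'.source)

/-- The product of two manifolds is modelled on the product of the model spaces. -/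
instance productChartedSpace (E : Type*) [TopologicalSpace E] (M : Type*) [TopologicalSpace M]
    [ChartedSpace E M] (E' : Type*) [TopologicalSpace E'] (M' : Type*) [TopologicalSpace M']
    [ChartedSpace E' M'] : ChartedSpace (E × E') (M × M') :=
  prodChartedSpace E M E' M'

/-- `f : M → M'` is smooth on the open set `W`: continuous on `W`, and smooth in all charts. -/
def MSmoothOn (𝕜 : Type*) [RCLike 𝕜] (E E' : Type*) [AddCommGroup E] [Module 𝕜 E]
    [TopologicalSpace E] [AddCommGroup E'] [Module 𝕜 E'] [TopologicalSpace E']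
    {M M' : Type*} [TopologicalSpace M] [ChartedSpace E M] [TopologicalSpace M']
    [ChartedSpace E' M'] (f : M → M') (W : Set M) : Prop :=
  ContinuousOn f W ∧ ∀ e ∈ atlas E M, ∀ e' ∈ atlas E' M',
    IsSmoothOn 𝕜 (e' ∘ f ∘ e.symm) (e.target ∩ e.symm ⁻¹' (W ∩ f ⁻¹' e'.source))

variable {𝕜 : Type*} [RCLike 𝕜]
  {E : Type*} [AddCommGroup E] [Module 𝕜 E] [TopologicalSpace E]
  {E' : Type*} [AddCommGroup E'] [Module 𝕜 E'] [TopologicalSpace E']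
  {E'' : Type*} [AddCommGroup E''] [Module 𝕜 E''] [TopologicalSpace E'']
  {M : Type*} [TopologicalSpace M] [ChartedSpace E M]
  {M' : Type*} [TopologicalSpace M'] [ChartedSpace E' M']
  {M'' : Type*} [TopologicalSpace M''] [ChartedSpace E'' M'']

theorem mem_atlas_prod {c : OpenPartialHomeomorph (M × M') (E × E')} :
    c ∈ atlas (E × E') (M × M') ↔ ∃ e ∈ atlas E M, ∃ e' ∈ atlas E' M', e.prod e' = c :=
  Iff.rfl

theorem MSmoothOn.mono {f : M → M'} {W W' : Set M} (h : MSmoothOn 𝕜 E E' f W) (hW : W' ⊆ W) :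
    MSmoothOn 𝕜 E E' f W' :=
  ⟨h.1.mono hW, fun e he e' he' n => (h.2 e he e' he' n).mono
    (inter_subset_inter_right _ (preimage_mono (inter_subset_inter_left _ hW)))⟩

theorem MSmoothOn.congr [IsTopologicalAddGroup E] [ContinuousSMul 𝕜 E] {f g : M → M'} {W : Set M}
    (h : MSmoothOn 𝕜 E E' f W) (hW : IsOpen W) (hfg : EqOn f g W) : MSmoothOn 𝕜 E E' g W := by
  have hc := h.1.congr hfg.symm
  refine ⟨hc, fun e he e' he' n => ?_⟩
  refine ((h.2 e he e' he' n).mono ?_).congr ?_ ?_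
  · rintro x ⟨hx, hxW, hx'⟩
    refine ⟨hx, hxW, ?_⟩
    simpa [mem_preimage, hfg hxW] using hx'
  · exact e.symm.isOpen_inter_preimage (hc.isOpen_inter_preimage hW e'.open_source)
  · rintro x ⟨hx, hxW, hx'⟩
    simp [hfg hxW]

theorem MSmoothOn.comp [IsTopologicalAddGroup E] [ContinuousSMul 𝕜 E] [IsTopologicalAddGroup E']
    [ContinuousSMul 𝕜 E'] [PolynormableSpace 𝕜 E''] [T2Space E''] {f : M → M'} {g : M' → M''}
    {W : Set M} {W' : Set M'} (hg : MSmoothOn 𝕜 E' E'' g W') (hf : MSmoothOn 𝕜 E E' f W)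
    (hW : IsOpen W) (hW' : IsOpen W') (hm : MapsTo f W W') : MSmoothOn 𝕜 E E'' (g ∘ f) W := by
  have hc := hg.1.comp hf.1 hm
  refine ⟨hc, fun e he e'' he'' n => IsCk.of_local ?_⟩
  rintro x ⟨hx, hxW, hx''⟩
  set e' := chartAt E' (f (e.symm x)) with he'
  have hs : f (e.symm x) ∈ e'.source := mem_chart_source E' _
  set O : Set E := e.target ∩ e.symm ⁻¹' ((W ∩ (g ∘ f) ⁻¹' e''.source) ∩ (W ∩ f ⁻¹' e'.source))
    with hO
  have hOo : IsOpen O := e.symm.isOpen_inter_preimage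
    ((hc.isOpen_inter_preimage hW e''.open_source).inter
      (hf.1.isOpen_inter_preimage hW e'.open_source))
  refine ⟨O, hOo, ⟨hx, ⟨hxW, hx''⟩, hxW, hs⟩, ?_⟩
  have h1 : IsCk 𝕜 n (e' ∘ f ∘ e.symm) O := (hf.2 e he e' (chart_mem_atlas _ _) n).mono
    fun y hy => ⟨hy.1, hy.2.2⟩
  have h2 := hg.2 e' (chart_mem_atlas _ _) e'' he'' n
  have h3 := IsCk.comp hOo (e'.symm.isOpen_inter_preimage
    (hg.1.isOpen_inter_preimage hW' e''.open_source)) ?_ h2 h1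
  · refine h3.congr hOo ?_
    rintro y ⟨hy, -, -, hy'⟩
    simp only [Function.comp]
    rw [e'.left_inv hy']
  · rintro y ⟨hy, ⟨hyW, hy''⟩, -, hy'⟩
    refine ⟨e'.map_source hy', ?_⟩
    simp only [mem_preimage, Function.comp] at hy' hy'' ⊢
    rw [e'.left_inv hy']
    exact ⟨hm hyW, hy''⟩

theorem MSmoothOn.prodMk {f : M → M'} {g : M → M''} {W : Set M} (hf : MSmoothOn 𝕜 E E' f W)
    (hg : MSmoothOn 𝕜 E E'' g W) : MSmoothOn 𝕜 E (E' × E'') (fun x => (f x, g x)) W := by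
  refine ⟨hf.1.prodMk hg.1, fun e he c hc n => ?_⟩
  obtain ⟨e', he', e'', he'', rfl⟩ := mem_atlas_prod.1 hc
  exact ((hf.2 e he e' he' n).mono fun y hy => ⟨hy.1, hy.2.1, hy.2.2.1⟩).prodMk
    ((hg.2 e he e'' he'' n).mono fun y hy => ⟨hy.1, hy.2.1, hy.2.2.2⟩)

theorem mSmoothOn_id [IsSmoothManifold 𝕜 E M] (W : Set M) : MSmoothOn 𝕜 E E (id : M → M) W :=
  ⟨continuousOn_id, fun e he e' he' n => (IsSmoothManifold.compat e he e' he' n).mono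
    fun _ hy => ⟨hy.1, hy.2.2⟩⟩

theorem mSmoothOn_const (c : M') (W : Set M) : MSmoothOn 𝕜 E E' (fun _ : M => c) W :=
  ⟨continuousOn_const, fun _ _ e' _ n => isCk_const n (e' c) _⟩

theorem mSmoothOn_fst [IsSmoothManifold 𝕜 E M] (W : Set (M × M')) :
    MSmoothOn 𝕜 (E × E') E (Prod.fst : M × M' → M) W := by
  refine ⟨continuousOn_fst, fun c hc e₂ he₂ n => ?_⟩
  obtain ⟨e, he, e', he', rfl⟩ := mem_atlas_prod.1 hc
  exact ((IsSmoothManifold.compat (𝕜 := 𝕜) e he e₂ he₂ n).comp_clm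
    (ContinuousLinearMap.fst 𝕜 E E')).mono fun y hy => ⟨hy.1.1, hy.2.2⟩

theorem mSmoothOn_snd [IsSmoothManifold 𝕜 E' M'] (W : Set (M × M')) :
    MSmoothOn 𝕜 (E × E') E' (Prod.snd : M × M' → M') W := by
  refine ⟨continuousOn_snd, fun c hc e₂ he₂ n => ?_⟩
  obtain ⟨e, he, e', he', rfl⟩ := mem_atlas_prod.1 hc
  exact ((IsSmoothManifold.compat (𝕜 := 𝕜) e' he' e₂ he₂ n).comp_clm
    (ContinuousLinearMap.snd 𝕜 E E')).mono fun y hy => ⟨hy.1.2, hy.2.2⟩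

end Manifolds

section LieGroups

instance productIsSmoothManifold (𝕜 : Type*) [RCLike 𝕜]
    (E : Type*) [AddCommGroup E] [Module 𝕜 E] [TopologicalSpace E]
    (E' : Type*) [AddCommGroup E'] [Module 𝕜 E'] [TopologicalSpace E']
    (M : Type*) [TopologicalSpace M] [ChartedSpace E M] [IsSmoothManifold 𝕜 E M]
    (M' : Type*) [TopologicalSpace M'] [ChartedSpace E' M'] [IsSmoothManifold 𝕜 E' M'] :
    IsSmoothManifold 𝕜 (E × E') (M × M') where
  compat c hc c' hc' n := by
    obtain ⟨e₁, h₁, e₂, h₂, rfl⟩ := mem_atlas_prod.1 hc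
    obtain ⟨e₁', h₁', e₂', h₂', rfl⟩ := mem_atlas_prod.1 hc'
    exact (((IsSmoothManifold.compat (𝕜 := 𝕜) e₁ h₁ e₁' h₁' n).comp_clm
      (ContinuousLinearMap.fst 𝕜 E E')).mono fun y hy => ⟨hy.1.1, hy.2.1⟩).prodMk
      (((IsSmoothManifold.compat (𝕜 := 𝕜) e₂ h₂ e₂' h₂' n).comp_clm
      (ContinuousLinearMap.snd 𝕜 E E')).mono fun y hy => ⟨hy.1.2, hy.2.2⟩)

/-- A group that is a smooth manifold modelled on `E` with smooth multiplication and inversion.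
Wherever it is used, `E` is a Hausdorff locally convex space. -/
class IsLieGroup (𝕜 : Type*) [RCLike 𝕜] (E : Type*) [AddCommGroup E] [Module 𝕜 E]
    [TopologicalSpace E] (G : Type*) [Group G] [TopologicalSpace G] [ChartedSpace E G] : Prop
    extends IsSmoothManifold 𝕜 E G where
  smooth_mul : MSmoothOn 𝕜 (E × E) E (fun p : G × G => p.1 * p.2) univ
  smooth_inv : MSmoothOn 𝕜 E E (fun g : G => g⁻¹) univ

/-- `f` is smooth on some open neighbourhood of `1`. -/
def LocallySmooth (𝕜 : Type*) [RCLike 𝕜] (E E' : Type*) [AddCommGroup E] [Module 𝕜 E]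
    [TopologicalSpace E] [AddCommGroup E'] [Module 𝕜 E'] [TopologicalSpace E']
    {M M' : Type*} [One M] [TopologicalSpace M] [ChartedSpace E M] [TopologicalSpace M']
    [ChartedSpace E' M'] (f : M → M') : Prop :=
  ∃ U : Set M, IsOpen U ∧ 1 ∈ U ∧ MSmoothOn 𝕜 E E' f U

section LocallySmooth

variable {𝕜 : Type*} [RCLike 𝕜]
  {E : Type*} [AddCommGroup E] [Module 𝕜 E] [TopologicalSpace E]
  {E' : Type*} [AddCommGroup E'] [Module 𝕜 E'] [TopologicalSpace E']
  {E'' : Type*} [AddCommGroup E''] [Module 𝕜 E''] [TopologicalSpace E'']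
  {M : Type*} [One M] [TopologicalSpace M] [ChartedSpace E M]
  {M' : Type*} [TopologicalSpace M'] [ChartedSpace E' M']
  {M'' : Type*} [TopologicalSpace M''] [ChartedSpace E'' M'']

theorem MSmoothOn.locallySmooth {f : M → M'} (h : MSmoothOn 𝕜 E E' f univ) :
    LocallySmooth 𝕜 E E' f :=
  ⟨univ, isOpen_univ, mem_univ _, h⟩

theorem LocallySmooth.comp [One M'] [IsTopologicalAddGroup E] [ContinuousSMul 𝕜 E]
    [IsTopologicalAddGroup E'] [ContinuousSMul 𝕜 E'] [PolynormableSpace 𝕜 E''] [T2Space E'']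
    {g : M' → M''} {f : M → M'} (hg : LocallySmooth 𝕜 E' E'' g) (hf : LocallySmooth 𝕜 E E' f)
    (h1 : f 1 = 1) : LocallySmooth 𝕜 E E'' (fun x => g (f x)) := by
  obtain ⟨V, hV, h1V, hg⟩ := hg
  obtain ⟨U, hU, h1U, hf⟩ := hf
  have hO := hf.1.isOpen_inter_preimage hU hV
  exact ⟨U ∩ f ⁻¹' V, hO, ⟨h1U, by simpa [h1] using h1V⟩,
    hg.comp (hf.mono inter_subset_left) hO hV fun x hx => hx.2⟩

theorem LocallySmooth.prodMk {f : M → M'} {g : M → M''} (hf : LocallySmooth 𝕜 E E' f)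
    (hg : LocallySmooth 𝕜 E E'' g) : LocallySmooth 𝕜 E (E' × E'') (fun x => (f x, g x)) := by
  obtain ⟨V, hV, h1V, hg⟩ := hg
  obtain ⟨U, hU, h1U, hf⟩ := hf
  exact ⟨U ∩ V, hU.inter hV, ⟨h1U, h1V⟩,
    (hf.mono inter_subset_left).prodMk (hg.mono inter_subset_right)⟩

variable {N : Type*} [Group N] [TopologicalSpace N] [ChartedSpace E' N] [IsLieGroup 𝕜 E' N]
  [IsTopologicalAddGroup E] [ContinuousSMul 𝕜 E] [IsTopologicalAddGroup E'] [ContinuousSMul 𝕜 E']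
  [PolynormableSpace 𝕜 E'] [T2Space E']

theorem MSmoothOn.locallySmooth_comp {W : Type*} [One W] [TopologicalSpace W] [ChartedSpace E W]
    {g : M' → M''} {f : W → M'} [PolynormableSpace 𝕜 E''] [T2Space E'']
    (hg : MSmoothOn 𝕜 E' E'' g univ) (hf : LocallySmooth 𝕜 E E' f) :
    LocallySmooth 𝕜 E E'' (fun x => g (f x)) := by
  obtain ⟨U, hU, h1U, hf⟩ := hf
  exact ⟨U, hU, h1U, hg.comp hf hU isOpen_univ (mapsTo_univ _ _)⟩

theorem LocallySmooth.mul {f g : M → N} (hf : LocallySmooth 𝕜 E E' f)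
    (hg : LocallySmooth 𝕜 E E' g) : LocallySmooth 𝕜 E E' (fun x => f x * g x) :=
  (IsLieGroup.smooth_mul (𝕜 := 𝕜) (E := E') (G := N)).locallySmooth_comp (hf.prodMk hg)

theorem LocallySmooth.inv {f : M → N} (hf : LocallySmooth 𝕜 E E' f) :
    LocallySmooth 𝕜 E E' (fun x => (f x)⁻¹) :=
  (IsLieGroup.smooth_inv (𝕜 := 𝕜) (E := E') (G := N)).locallySmooth_comp hf

end LocallySmooth

end LieGroups

/-- `δ_f(g, g') = f(g) f(g') f(gg')⁻¹`. -/
def deltaMap {G H : Type*} [Group G] [Group H] (f : G → H) (g g' : G) : H :=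
  f g * f g' * (f (g * g'))⁻¹

/-- `(d_S ω)(g, g', g'') = S(g)(ω(g', g'')) ω(g, g'g'') ω(gg', g'')⁻¹ ω(g, g')⁻¹`. -/
def dCochain {G N : Type*} [Group G] [Group N] (S : G → MulAut N) (ω : G → G → N)
    (g g' g'' : G) : N :=
  S g (ω g' g'') * ω g (g' * g'') * (ω (g * g') g'')⁻¹ * (ω g g')⁻¹

section Algebra

variable {G N : Type*} [Group G] [Group N] {S : G → MulAut N} {ω : G → G → N}

theorem conj_lift_apply (h : ∀ a b, deltaMap S a b = MulAut.conj (ω a b)) (a b : G) (n : N) :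
    S a (S b n) = ω a b * S (a * b) n * (ω a b)⁻¹ := by
  have h' : S a * S b = MulAut.conj (ω a b) * S (a * b) := by
    rw [← h, deltaMap, inv_mul_cancel_right]
  simpa using DFunLike.congr_fun h' n

theorem dCochain_rel (S : G → MulAut N) (ω : G → G → N) (a b c : G) :
    S a (ω b c) * ω a (b * c) = dCochain S ω a b c * ω a b * ω (a * b) c := by
  simp [dCochain]

theorem dCochain_mem_center (h : ∀ a b, deltaMap S a b = MulAut.conj (ω a b)) (a b c : G) :
    dCochain S ω a b c ∈ Subgroup.center N := by
  rw [Subgroup.mem_center_iff]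
  intro n
  have hs : ∀ m, S a (ω b c) * ω a (b * c) * S (a * (b * c)) m
      = ω a b * (ω (a * b) c * S (a * (b * c)) m * (ω (a * b) c)⁻¹) * (ω a b)⁻¹ *
        (S a (ω b c) * ω a (b * c)) := by
    intro m
    have h1 : S a (S b (S c m)) = S a (ω b c) * ω a (b * c) * S (a * (b * c)) m *
        (ω a (b * c))⁻¹ * (S a (ω b c))⁻¹ := by
      rw [conj_lift_apply h b c, map_mul, map_mul, map_inv, conj_lift_apply h a (b * c)]
      group
    have h2 : S a (S b (S c m)) =
        ω a b * (ω (a * b) c * S (a * (b * c)) m * (ω (a * b) c)⁻¹) * (ω a b)⁻¹ := by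
      rw [conj_lift_apply h a b, conj_lift_apply h (a * b) c, mul_assoc a b c]
    rw [← h2, h1]
    group
  obtain ⟨m, hm⟩ := (S (a * (b * c))).surjective ((ω (a * b) c)⁻¹ * (ω a b)⁻¹ * n * ω a b *
    ω (a * b) c)
  have := hs m
  rw [hm, dCochain_rel] at this
  set F := dCochain S ω a b c
  have e1 : F * ω a b * ω (a * b) c *
      ((ω (a * b) c)⁻¹ * (ω a b)⁻¹ * n * ω a b * ω (a * b) c) =
      F * n * (ω a b * ω (a * b) c) := by group
  have e2 : ω a b * (ω (a * b) c * ((ω (a * b) c)⁻¹ * (ω a b)⁻¹ * n * ω a b * ω (a * b) c) *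
      (ω (a * b) c)⁻¹) * (ω a b)⁻¹ * (F * ω a b * ω (a * b) c) =
      n * F * (ω a b * ω (a * b) c) := by group
  rw [e1, e2] at this
  exact (mul_right_cancel this).symm

theorem dCochain_cocycle (h : ∀ a b, deltaMap S a b = MulAut.conj (ω a b)) (a b c d : G) :
    S a (dCochain S ω b c d) * dCochain S ω a (b * c) d * dCochain S ω a b c =
      dCochain S ω a b (c * d) * dCochain S ω (a * b) c d := by
  have hc : ∀ x y z n, n * dCochain S ω x y z = dCochain S ω x y z * n := fun x y z n =>
    Subgroup.mem_center_iff.1 (dCochain_mem_center h x y z) n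
  have way1 : S a (S b (ω c d) * ω b (c * d)) * ω a (b * (c * d)) =
      S a (dCochain S ω b c d) * dCochain S ω a (b * c) d * dCochain S ω a b c *
        (ω a b * ω (a * b) c * ω (a * b * c) d) := by
    rw [dCochain_rel, map_mul, map_mul, ← mul_assoc b c d, mul_assoc, dCochain_rel S ω a (b * c) d,
      mul_assoc, mul_assoc (S a _), ← mul_assoc (S a (ω b c)), ← mul_assoc (S a (ω b c)), hc,
      mul_assoc (dCochain S ω a (b * c) d), dCochain_rel S ω a b c, mul_assoc a b c]
    simp only [mul_assoc]
  have way2 : S a (S b (ω c d) * ω b (c * d)) * ω a (b * (c * d)) =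
      dCochain S ω a b (c * d) * dCochain S ω (a * b) c d *
        (ω a b * ω (a * b) c * ω (a * b * c) d) := by
    rw [map_mul, mul_assoc, dCochain_rel, conj_lift_apply h a b]
    have h3 := dCochain_rel S ω (a * b) c d
    have e : ω a b * S (a * b) (ω c d) * (ω a b)⁻¹ *
        (dCochain S ω a b (c * d) * ω a b * ω (a * b) (c * d)) =
        dCochain S ω a b (c * d) * (ω a b * (S (a * b) (ω c d) * ω (a * b) (c * d))) := by
      rw [mul_assoc (dCochain S ω a b (c * d)), ← mul_assoc _ (dCochain S ω a b (c * d)), hc]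
      group
    rw [e, h3, mul_assoc (dCochain S ω (a * b) c d), ← mul_assoc (ω a b), hc]
    simp only [mul_assoc]
  exact mul_right_cancel (way1.symm.trans way2)

theorem dCochain_mul_central {β : G → G → N} (hβ : ∀ a b, β a b ∈ Subgroup.center N)
    (a b c : G) : dCochain S (fun x y => ω x y * β x y) a b c =
      dCochain S ω a b c * dCochain S β a b c := by
  have hc : ∀ x y n, β x y * n = n * β x y := fun x y n =>
    (Subgroup.mem_center_iff.1 (hβ x y) n).symm
  have hs : ∀ n, S a (β b c) * n = n * S a (β b c) := fun n => by
    obtain ⟨m, rfl⟩ := (S a).surjective n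
    rw [← map_mul, hc, map_mul]
  have hi : ∀ x y n, (β x y)⁻¹ * n = n * (β x y)⁻¹ := fun x y n => by
    rw [inv_mul_eq_iff_eq_mul, ← mul_assoc, hc, mul_inv_cancel_right]
  simp only [dCochain, map_mul, mul_inv_rev, mul_assoc]
  have h2 := hc a (b * c)
  have h3 := hi (a * b) c
  have h4 := hi a b
  generalize S a (β b c) = z₁ at *
  generalize β a (b * c) = z₂ at *
  generalize (β (a * b) c)⁻¹ = z₃ at *
  generalize (β a b)⁻¹ = z₄ at *
  generalize (ω a b)⁻¹ = t at *
  generalize (ω (a * b) c)⁻¹ = r at *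
  rw [h4 t, h3 (r * _), h2 (_ * z₃), hs (_ * _), hs (z₂ * _), h2 (z₃ * _), h3 z₄]
  simp only [mul_assoc]

end Algebra


section LocallySmoothCochains

variable (𝕜 : Type*) [RCLike 𝕜]
  (E : Type*) [AddCommGroup E] [Module 𝕜 E] [TopologicalSpace E]
  (F : Type*) [AddCommGroup F] [Module 𝕜 F] [TopologicalSpace F]
  {G : Type*} [Group G] [TopologicalSpace G] [ChartedSpace E G]
  {N : Type*} [Group N] [TopologicalSpace N] [ChartedSpace F N]

/-- `f ∈ C¹_s(G, N)`: normalized and locally smooth. -/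
structure IsC1 (f : G → N) : Prop where
  map_one : f 1 = 1
  locallySmooth : LocallySmooth 𝕜 E F f

/-- `f ∈ C²_s(G, N)`: normalized and locally smooth. -/
structure IsC2 (f : G → G → N) : Prop where
  one_left : ∀ g, f 1 g = 1
  one_right : ∀ g, f g 1 = 1
  locallySmooth : LocallySmooth 𝕜 (E × E) F (fun p : G × G => f p.1 p.2)

/-- `f ∈ C²_ss(G, N)`: in addition, for each `g` the map `x ↦ f(g, x) f(gxg⁻¹, g)⁻¹` is smooth
in an identity neighbourhood. -/
structure IsC2ss (f : G → G → N) : Prop extends IsC2 𝕜 E F f where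
  locallySmooth_twist : ∀ g, LocallySmooth 𝕜 E F (fun x => f g x * (f (g * x * g⁻¹) g)⁻¹)

/-- `f ∈ C³_s(G, N)`: normalized and locally smooth. -/
structure IsC3 (f : G → G → G → N) : Prop where
  one_left : ∀ g g', f 1 g g' = 1
  one_mid : ∀ g g', f g 1 g' = 1
  one_right : ∀ g g', f g g' 1 = 1
  locallySmooth : LocallySmooth 𝕜 (E × E × E) F (fun p : G × G × G => f p.1 p.2.1 p.2.2)

/-- `φ` belongs to the group `Aut(N)` of Lie group automorphisms of `N`. -/
def IsLieAut (φ : MulAut N) : Prop :=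
  MSmoothOn 𝕜 F F (fun n => φ n) univ ∧ MSmoothOn 𝕜 F F (fun n => φ⁻¹ n) univ

/-- `S ∈ C¹_s(G, Aut(N))`. -/
structure IsC1Aut (S : G → MulAut N) : Prop where
  isLieAut : ∀ g, IsLieAut 𝕜 F (S g)
  map_one : S 1 = 1
  smooth_near_one : ∃ U : Set G, IsOpen U ∧ 1 ∈ U ∧
    MSmoothOn 𝕜 (E × F) F (fun p : G × N => S p.1 p.2) (U ×ˢ univ)

/-- `S ∈ C¹_s(G, Aut(N))` with `δ_S = C_N ∘ ω` for some `ω ∈ C²_s(G, N)`. -/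
structure IsSmoothOuterAction (S : G → MulAut N) : Prop where
  isC1Aut : IsC1Aut 𝕜 E F S
  exists_lift : ∃ ω : G → G → N, IsC2 𝕜 E F ω ∧
    ∀ g g', deltaMap S g g' = MulAut.conj (ω g g')

/-- `S ∈ C¹_s(G, Aut(N))` with `δ_S = C_N ∘ ω` for some `ω ∈ C²_ss(G, N)`. -/
structure IsStronglySmoothOuterAction (S : G → MulAut N) : Prop where
  isC1Aut : IsC1Aut 𝕜 E F S
  exists_lift : ∃ ω : G → G → N, IsC2ss 𝕜 E F ω ∧
    ∀ g g', deltaMap S g g' = MulAut.conj (ω g g')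

/-- `S ∼ S'`, i.e. `S' = (C_N ∘ h) · S` for some `h ∈ C¹_s(G, N)`. -/
def OuterEquiv (S S' : G → MulAut N) : Prop :=
  ∃ h : G → N, IsC1 𝕜 E F h ∧ ∀ g, S' g = MulAut.conj (h g) * S g

end LocallySmoothCochains

section Cohomology

open scoped IsMulCommutative

/-- The differential `d_S` on `Z(N)`-valued 2-cochains, for `G` acting on `Z(N)` through `S`. -/
def d₂ {G N : Type*} [Group G] [Group N] (S : G → MulAut N) :
    (G → G → Subgroup.center N) →* (G → G → G → Subgroup.center N) where
  toFun f g₀ g₁ g₂ := Subgroup.centerCongr (S g₀) (f g₁ g₂) * (f (g₀ * g₁) g₂)⁻¹ *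
    f g₀ (g₁ * g₂) * (f g₀ g₁)⁻¹
  map_one' := by funext; simp
  map_mul' f f' := by
    funext g₀ g₁ g₂
    simp only [Pi.mul_apply, map_mul, mul_inv]
    ac_rfl

/-- The differential `d_S` on `Z(N)`-valued 3-cochains. -/
def d₃ {G N : Type*} [Group G] [Group N] (S : G → MulAut N) :
    (G → G → G → Subgroup.center N) →* (G → G → G → G → Subgroup.center N) where
  toFun f g₀ g₁ g₂ g₃ := Subgroup.centerCongr (S g₀) (f g₁ g₂ g₃) * (f (g₀ * g₁) g₂ g₃)⁻¹ *
    f g₀ (g₁ * g₂) g₃ * (f g₀ g₁ (g₂ * g₃))⁻¹ * f g₀ g₁ g₂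
  map_one' := by funext; simp
  map_mul' f f' := by
    funext g₀ g₁ g₂ g₃
    simp only [Pi.mul_apply, map_mul, mul_inv]
    ac_rfl

/-- If `δ_S = C_N ∘ ω`, then `d_S ω` takes values in `Z(N)`. -/
def dCentral {G N : Type*} [Group G] [Group N] {S : G → MulAut N} {ω : G → G → N}
    (h : ∀ g g', deltaMap S g g' = MulAut.conj (ω g g')) (g g' g'' : G) : Subgroup.center N :=
  ⟨dCochain S ω g g' g'', dCochain_mem_center h g g' g''⟩

theorem d₃_dCentral {G N : Type*} [Group G] [Group N] {S : G → MulAut N} {ω : G → G → N}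
    (h : ∀ g g', deltaMap S g g' = MulAut.conj (ω g g')) : d₃ S (dCentral h) = 1 := by
  funext a b c d
  have h1 : Subgroup.centerCongr (S a) (dCentral h b c d) * dCentral h a (b * c) d *
      dCentral h a b c = dCentral h a b (c * d) * dCentral h (a * b) c d :=
    Subtype.ext (dCochain_cocycle h a b c d)
  change Subgroup.centerCongr (S a) (dCentral h b c d) * (dCentral h (a * b) c d)⁻¹ *
    dCentral h a (b * c) d * (dCentral h a b (c * d))⁻¹ * dCentral h a b c = 1
  have h2 : Subgroup.centerCongr (S a) (dCentral h b c d) * (dCentral h (a * b) c d)⁻¹ *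
    dCentral h a (b * c) d * (dCentral h a b (c * d))⁻¹ * dCentral h a b c =
    (Subgroup.centerCongr (S a) (dCentral h b c d) * dCentral h a (b * c) d * dCentral h a b c) *
      (dCentral h a b (c * d) * dCentral h (a * b) c d)⁻¹ := by
    rw [mul_inv]; ac_rfl
  rw [h2, h1, mul_inv_cancel]

theorem coe_d₂ {G N : Type*} [Group G] [Group N] (S : G → MulAut N)
    (f : G → G → Subgroup.center N) (a b c : G) :
    (d₂ S f a b c : N) = dCochain S (fun x y => (f x y : N)) a b c := by
  have h : d₂ S f a b c = Subgroup.centerCongr (S a) (f b c) * f a (b * c) *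
      (f (a * b) c)⁻¹ * (f a b)⁻¹ := by
    change Subgroup.centerCongr (S a) (f b c) * (f (a * b) c)⁻¹ *
      f a (b * c) * (f a b)⁻¹ = _
    ac_rfl
  rw [h]
  rfl

variable (𝕜 : Type*) [RCLike 𝕜]
  (E : Type*) [AddCommGroup E] [Module 𝕜 E] [TopologicalSpace E] [IsTopologicalAddGroup E]
  [ContinuousSMul 𝕜 E]
  (F : Type*) [AddCommGroup F] [Module 𝕜 F] [TopologicalSpace F] [IsTopologicalAddGroup F]
  [ContinuousSMul 𝕜 F] [PolynormableSpace 𝕜 F] [T2Space F]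
  {G : Type*} [Group G] [TopologicalSpace G] [ChartedSpace E G]
  {N : Type*} [Group N] [TopologicalSpace N] [ChartedSpace F N] [IsLieGroup 𝕜 F N]

variable (G N) in
/-- The group `C²_s(G, Z(N))`; smoothness is that of `N`-valued maps. -/
def C₂Center : Subgroup (G → G → Subgroup.center N) where
  carrier := {f | IsC2 𝕜 E F fun g g' => (f g g' : N)}
  one_mem' := ⟨fun _ => rfl, fun _ => rfl, (mSmoothOn_const 1 _).locallySmooth⟩
  mul_mem' {f f'} hf hf' := ⟨fun g => by simp [hf.one_left, hf'.one_left],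
    fun g => by simp [hf.one_right, hf'.one_right], hf.locallySmooth.mul hf'.locallySmooth⟩
  inv_mem' {f} hf := ⟨fun g => by simp [hf.one_left],
    fun g => by simp [hf.one_right], hf.locallySmooth.inv⟩

variable (G N) in
/-- The group `C²_ss(G, Z(N))`. -/
def C₂ssCenter : Subgroup (G → G → Subgroup.center N) where
  carrier := {f | IsC2ss 𝕜 E F fun g g' => (f g g' : N)}
  one_mem' := ⟨(C₂Center 𝕜 E F G N).one_mem, fun g => by
    simpa using (mSmoothOn_const (1 : N) _).locallySmooth⟩
  mul_mem' {f f'} hf hf' := ⟨(C₂Center 𝕜 E F G N).mul_mem hf.toIsC2 hf'.toIsC2, fun g => by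
    convert (hf.locallySmooth_twist g).mul (hf'.locallySmooth_twist g) using 2 with x
    have : (f * f') g x * ((f * f') (g * x * g⁻¹) g)⁻¹ = (f g x * (f (g * x * g⁻¹) g)⁻¹) *
        (f' g x * (f' (g * x * g⁻¹) g)⁻¹) := by
      simp only [Pi.mul_apply, mul_inv]
      ac_rfl
    exact congrArg Subtype.val this⟩
  inv_mem' {f} hf := ⟨(C₂Center 𝕜 E F G N).inv_mem hf.toIsC2, fun g => by
    convert (hf.locallySmooth_twist g).inv using 2 with x
    have : f⁻¹ g x * (f⁻¹ (g * x * g⁻¹) g)⁻¹ = (f g x * (f (g * x * g⁻¹) g)⁻¹)⁻¹ := by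
      simp only [Pi.inv_apply, mul_inv]
    exact congrArg Subtype.val this⟩

variable (G N) in
/-- The group `C³_s(G, Z(N))`. -/
def C₃Center : Subgroup (G → G → G → Subgroup.center N) where
  carrier := {f | IsC3 𝕜 E F fun g g' g'' => (f g g' g'' : N)}
  one_mem' := ⟨fun _ _ => rfl, fun _ _ => rfl, fun _ _ => rfl,
    (mSmoothOn_const 1 _).locallySmooth⟩
  mul_mem' {f f'} hf hf' := ⟨fun g g' => by simp [hf.one_left, hf'.one_left],
    fun g g' => by simp [hf.one_mid, hf'.one_mid],
    fun g g' => by simp [hf.one_right, hf'.one_right], hf.locallySmooth.mul hf'.locallySmooth⟩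
  inv_mem' {f} hf := ⟨fun g g' => by simp [hf.one_left],
    fun g g' => by simp [hf.one_mid], fun g g' => by simp [hf.one_right], hf.locallySmooth.inv⟩

/-- The group of cocycles `Z³_s(G, Z(N))_S`. -/
def Z₃ (S : G → MulAut N) : Subgroup (G → G → G → Subgroup.center N) :=
  C₃Center 𝕜 E F G N ⊓ (d₃ S).ker

/-- `H³_s(G, Z(N))_S = Z³_s(G, Z(N))_S / d_S(C²_s(G, Z(N)))`. The coboundaries form a subgroup of
`Z³_s(G, Z(N))_S` when `S` is a smooth outer action: see `map_C₂Center_le_Z₃`. -/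
abbrev H₃s (S : G → MulAut N) : Type _ :=
  Z₃ 𝕜 E F S ⧸ ((C₂Center 𝕜 E F G N).map (d₂ S)).subgroupOf (Z₃ 𝕜 E F S)

/-- `H³_ss(G, Z(N))_S = Z³_s(G, Z(N))_S / d_S(C²_ss(G, Z(N)))`. -/
abbrev H₃ss (S : G → MulAut N) : Type _ :=
  Z₃ 𝕜 E F S ⧸ ((C₂ssCenter 𝕜 E F G N).map (d₂ S)).subgroupOf (Z₃ 𝕜 E F S)

instance (S : G → MulAut N) : CommGroup (H₃s 𝕜 E F S) :=
  QuotientGroup.Quotient.commGroup _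

variable {𝕜 E F}

theorem dCentral_mem_Z₃ [IsLieGroup 𝕜 E G] [PolynormableSpace 𝕜 E] [T2Space E]
    {S : G → MulAut N} (hS : IsC1Aut 𝕜 E F S) {ω : G → G → N}
    (hω : IsC2 𝕜 E F ω) (h : ∀ g g', deltaMap S g g' = MulAut.conj (ω g g')) :
    dCentral h ∈ Z₃ 𝕜 E F S := by
  refine ⟨⟨fun g g' => ?_, fun g g' => ?_, fun g g' => ?_, ?_⟩, d₃_dCentral h⟩
  · simp [dCentral, dCochain, hS.map_one, hω.one_left]
  · simp [dCentral, dCochain, hω.one_left, hω.one_right]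
  · simp [dCentral, dCochain, hω.one_right]
  · have hmul := (IsLieGroup.smooth_mul (𝕜 := 𝕜) (E := E) (G := G)).locallySmooth
    have e1 : LocallySmooth 𝕜 (E × E × E) E (fun p : G × G × G => p.1) :=
      (mSmoothOn_fst univ).locallySmooth
    have e23 : LocallySmooth 𝕜 (E × E × E) (E × E) (fun p : G × G × G => p.2) :=
      (mSmoothOn_snd univ).locallySmooth
    have e2 : LocallySmooth 𝕜 (E × E × E) E (fun p : G × G × G => p.2.1) :=
      (mSmoothOn_fst (𝕜 := 𝕜) (E := E) (M := G) (E' := E) (M' := G) univ).locallySmooth.comp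
        e23 rfl
    have e3 : LocallySmooth 𝕜 (E × E × E) E (fun p : G × G × G => p.2.2) :=
      (mSmoothOn_snd (𝕜 := 𝕜) (E := E) (M := G) (E' := E) (M' := G) univ).locallySmooth.comp
        e23 rfl
    have hSl : LocallySmooth 𝕜 (E × F) F (fun p : G × N => S p.1 p.2) := by
      obtain ⟨U, hU, h1, hs⟩ := hS.smooth_near_one
      exact ⟨_, hU.prod isOpen_univ, ⟨h1, mem_univ _⟩, hs⟩
    have t1 : LocallySmooth 𝕜 (E × E × E) F (fun p : G × G × G => S p.1 (ω p.2.1 p.2.2)) :=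
      hSl.comp (e1.prodMk (hω.locallySmooth.comp e23 rfl))
        (Prod.ext rfl (hω.one_left _))
    have t2 : LocallySmooth 𝕜 (E × E × E) F (fun p : G × G × G => ω p.1 (p.2.1 * p.2.2)) :=
      hω.locallySmooth.comp (e1.prodMk (hmul.comp e23 rfl)) (Prod.ext rfl (mul_one _))
    have t3 : LocallySmooth 𝕜 (E × E × E) F (fun p : G × G × G => ω (p.1 * p.2.1) p.2.2) :=
      hω.locallySmooth.comp ((hmul.comp (e1.prodMk e2) rfl).prodMk e3)
        (Prod.ext (mul_one _) rfl)
    have t4 : LocallySmooth 𝕜 (E × E × E) F (fun p : G × G × G => ω p.1 p.2.1) :=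
      hω.locallySmooth.comp (e1.prodMk e2) rfl
    exact ((t1.mul t2).mul t3.inv).mul t4.inv

theorem exists_central_of_lifts {S : G → MulAut N} {ω ω' : G → G → N}
    (h : ∀ g g', deltaMap S g g' = MulAut.conj (ω g g'))
    (h' : ∀ g g', deltaMap S g g' = MulAut.conj (ω' g g')) :
    ∃ β : G → G → Subgroup.center N, ∀ g g', ω' g g' = ω g g' * β g g' := by
  refine ⟨fun g g' => ⟨(ω g g')⁻¹ * ω' g g', ?_⟩, fun g g' => by simp⟩
  rw [Subgroup.mem_center_iff]
  intro n
  have := DFunLike.congr_fun ((h g g').symm.trans (h' g g')) n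
  simp only [MulAut.conj_apply] at this
  calc n * ((ω g g')⁻¹ * ω' g g')
      = (ω g g')⁻¹ * (ω g g' * n * (ω g g')⁻¹) * ω' g g' := by group
    _ = (ω g g')⁻¹ * ω' g g' * n := by rw [this]; group

theorem central_mem_C₂ {ω ω' : G → G → N} {β : G → G → Subgroup.center N}
    (hβ : ∀ g g', ω' g g' = ω g g' * β g g') (hω : IsC2 𝕜 E F ω) (hω' : IsC2 𝕜 E F ω') :
    β ∈ C₂Center 𝕜 E F G N := by
  have hb : ∀ g g', (β g g' : N) = (ω g g')⁻¹ * ω' g g' := fun g g' => by rw [hβ]; group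
  refine ⟨fun g => ?_, fun g => ?_, ?_⟩
  · simp [hb, hω.one_left, hω'.one_left]
  · simp [hb, hω.one_right, hω'.one_right]
  · simp only [hb]
    exact hω.locallySmooth.inv.mul hω'.locallySmooth

theorem central_mem_C₂ss {ω ω' : G → G → N} {β : G → G → Subgroup.center N}
    (hβ : ∀ g g', ω' g g' = ω g g' * β g g') (hω : IsC2ss 𝕜 E F ω) (hω' : IsC2ss 𝕜 E F ω') :
    β ∈ C₂ssCenter 𝕜 E F G N := by
  refine ⟨central_mem_C₂ hβ hω.toIsC2 hω'.toIsC2, fun g => ?_⟩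
  convert (hω.locallySmooth_twist g).inv.mul (hω'.locallySmooth_twist g) using 2 with x
  have hc : ∀ n : N, (n * β (g * x * g⁻¹) g : N) = β (g * x * g⁻¹) g * n := fun n =>
    Subgroup.mem_center_iff.1 (β (g * x * g⁻¹) g).2 n
  have hc' : ((β g x : N) * (β (g * x * g⁻¹) g : N)⁻¹) * (ω (g * x * g⁻¹) g)⁻¹ =
      (ω (g * x * g⁻¹) g)⁻¹ * ((β g x : N) * (β (g * x * g⁻¹) g : N)⁻¹) :=
    (Subgroup.mem_center_iff.1 (β g x * (β (g * x * g⁻¹) g)⁻¹).2 _).symm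
  have e : ω' g x * (ω' (g * x * g⁻¹) g)⁻¹ =
      ω g x * (ω (g * x * g⁻¹) g)⁻¹ * ((β g x : N) * (β (g * x * g⁻¹) g : N)⁻¹) := by
    rw [mul_assoc (ω g x), ← hc', hβ, hβ]
    group
  rw [e, inv_mul_cancel_left]

theorem dCentral_mul {S : G → MulAut N} {ω ω' : G → G → N} {β : G → G → Subgroup.center N}
    (hβ : ∀ g g', ω' g g' = ω g g' * β g g')
    (h : ∀ g g', deltaMap S g g' = MulAut.conj (ω g g'))
    (h' : ∀ g g', deltaMap S g g' = MulAut.conj (ω' g g')) :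
    dCentral h' = dCentral h * d₂ S β := by
  obtain rfl : ω' = fun g g' => ω g g' * β g g' := by funext g g'; exact hβ g g'
  funext a b c
  refine Subtype.ext ((dCochain_mul_central (fun x y => (β x y).2) a b c).trans ?_)
  rw [← coe_d₂]
  rfl

variable [IsLieGroup 𝕜 E G] [PolynormableSpace 𝕜 E] [T2Space E]

theorem map_C₂Center_le_Z₃ {S : G → MulAut N} (hS : IsSmoothOuterAction 𝕜 E F S) :
    (C₂Center 𝕜 E F G N).map (d₂ S) ≤ Z₃ 𝕜 E F S := by
  rintro _ ⟨β, hβ, rfl⟩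
  obtain ⟨ω, hω, h⟩ := hS.exists_lift
  have hω' : IsC2 𝕜 E F fun g g' => ω g g' * β g g' :=
    ⟨fun g => by simpa [hω.one_left] using hβ.one_left g,
      fun g => by simpa [hω.one_right] using hβ.one_right g,
      hω.locallySmooth.mul hβ.locallySmooth⟩
  have h' : ∀ g g', deltaMap S g g' = MulAut.conj (ω g g' * β g g') := fun g g' => by
    rw [h, map_mul]
    ext n
    simp [(Subgroup.mem_center_iff.1 (β g g').2 n).symm]
  have := dCentral_mul (fun _ _ => rfl) h h'
  rw [← inv_mul_eq_iff_eq_mul] at this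
  rw [← this]
  exact mul_mem (inv_mem (dCentral_mem_Z₃ hS.isC1Aut hω h)) (dCentral_mem_Z₃ hS.isC1Aut hω' h')

/-- The class `[d_S ω] ∈ H³_s(G, Z(N))_S`. -/
def charClassSOf {S : G → MulAut N} (hS : IsC1Aut 𝕜 E F S) {ω : G → G → N}
    (hω : IsC2 𝕜 E F ω) (h : ∀ g g', deltaMap S g g' = MulAut.conj (ω g g')) : H₃s 𝕜 E F S :=
  QuotientGroup.mk ⟨dCentral h, dCentral_mem_Z₃ hS hω h⟩

/-- The class `[d_S ω] ∈ H³_ss(G, Z(N))_S`. -/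
def charClassSsOf {S : G → MulAut N} (hS : IsC1Aut 𝕜 E F S) {ω : G → G → N}
    (hω : IsC2ss 𝕜 E F ω) (h : ∀ g g', deltaMap S g g' = MulAut.conj (ω g g')) : H₃ss 𝕜 E F S :=
  QuotientGroup.mk ⟨dCentral h, dCentral_mem_Z₃ hS hω.toIsC2 h⟩

/-- The class `[d_S ω]` does not depend on `ω`. -/
theorem charClassSOf_eq {S : G → MulAut N} (hS : IsC1Aut 𝕜 E F S) {ω ω' : G → G → N}
    (hω : IsC2 𝕜 E F ω) (h : ∀ g g', deltaMap S g g' = MulAut.conj (ω g g'))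
    (hω' : IsC2 𝕜 E F ω') (h' : ∀ g g', deltaMap S g g' = MulAut.conj (ω' g g')) :
    charClassSOf hS hω h = charClassSOf hS hω' h' := by
  obtain ⟨β, hβ⟩ := exists_central_of_lifts h h'
  refine QuotientGroup.eq.2 ⟨β, central_mem_C₂ hβ hω hω', ?_⟩
  exact (inv_mul_eq_iff_eq_mul.2 (dCentral_mul hβ h h')).symm

/-- The class `[d_S ω]` does not depend on `ω`. -/
theorem charClassSsOf_eq {S : G → MulAut N} (hS : IsC1Aut 𝕜 E F S) {ω ω' : G → G → N}
    (hω : IsC2ss 𝕜 E F ω) (h : ∀ g g', deltaMap S g g' = MulAut.conj (ω g g'))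
    (hω' : IsC2ss 𝕜 E F ω') (h' : ∀ g g', deltaMap S g g' = MulAut.conj (ω' g g')) :
    charClassSsOf hS hω h = charClassSsOf hS hω' h' := by
  obtain ⟨β, hβ⟩ := exists_central_of_lifts h h'
  refine QuotientGroup.eq.2 ⟨β, central_mem_C₂ss hβ hω hω', ?_⟩
  exact (inv_mul_eq_iff_eq_mul.2 (dCentral_mul hβ h h')).symm

/-- The characteristic class `χ_s(S) = [d_S ω]`, for any `ω ∈ C²_s(G, N)` with `δ_S = C_N ∘ ω`. -/
noncomputable def charClassS {S : G → MulAut N} (hS : IsSmoothOuterAction 𝕜 E F S) :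
    H₃s 𝕜 E F S :=
  charClassSOf hS.isC1Aut hS.exists_lift.choose_spec.1 hS.exists_lift.choose_spec.2

/-- The characteristic class `χ_ss(S) = [d_S ω]`, for any `ω ∈ C²_ss(G, N)` with `δ_S = C_N ∘ ω`. -/
noncomputable def charClassSs {S : G → MulAut N} (hS : IsStronglySmoothOuterAction 𝕜 E F S) :
    H₃ss 𝕜 E F S :=
  charClassSsOf hS.isC1Aut hS.exists_lift.choose_spec.1 hS.exists_lift.choose_spec.2

end Cohomology

section Extensions

universe uE uF uG uN

/-- A Lie group extension `1 → N → Total → G → 1`: a short exact sequence of Lie group morphisms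
for which `q : Total → G` is a smooth (locally trivial) principal bundle for the right action of
`N` through `ι`: over each small `U`, the map `Φ : U × N → q⁻¹(U)` is an `N`-equivariant
diffeomorphism over `U` with inverse `x ↦ (q x, Ψ x)`. -/
structure LieGroupExtension (𝕜 : Type*) [RCLike 𝕜]
    (E : Type uE) [AddCommGroup E] [Module 𝕜 E] [TopologicalSpace E]
    (F : Type uF) [AddCommGroup F] [Module 𝕜 F] [TopologicalSpace F]
    (G : Type uG) [Group G] [TopologicalSpace G] [ChartedSpace E G]
    (N : Type uN) [Group N] [TopologicalSpace N] [ChartedSpace F N] where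
  Model : Type (max uE uF)
  [addCommGroup : AddCommGroup Model]
  [module : Module 𝕜 Model]
  [topologicalSpaceModel : TopologicalSpace Model]
  [isTopologicalAddGroup : IsTopologicalAddGroup Model]
  [continuousSMul : ContinuousSMul 𝕜 Model]
  [polynormableSpace : PolynormableSpace 𝕜 Model]
  [t2Space : T2Space Model]
  Total : Type (max uG uN)
  [group : Group Total]
  [topologicalSpace : TopologicalSpace Total]
  [chartedSpace : ChartedSpace Model Total]
  [isLieGroup : IsLieGroup 𝕜 Model Total]
  ι : N →* Total
  q : Total →* G
  ι_injective : Function.Injective ι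
  range_ι : ι.range = q.ker
  q_surjective : Function.Surjective q
  ι_smooth : MSmoothOn 𝕜 F Model ι univ
  q_smooth : MSmoothOn 𝕜 Model E q univ
  locallyTrivial : ∀ g₀ : G, ∃ U : Set G, IsOpen U ∧ g₀ ∈ U ∧
    ∃ (Φ : G × N → Total) (Ψ : Total → N),
      MSmoothOn 𝕜 (E × F) Model Φ (U ×ˢ univ) ∧ MSmoothOn 𝕜 Model F Ψ (q ⁻¹' U) ∧
      (∀ g ∈ U, ∀ n, q (Φ (g, n)) = g ∧ Ψ (Φ (g, n)) = n) ∧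
      (∀ x, q x ∈ U → Φ (q x, Ψ x) = x) ∧
      ∀ g ∈ U, ∀ n n', Φ (g, n * n') = Φ (g, n) * ι n'

attribute [instance] LieGroupExtension.addCommGroup LieGroupExtension.module
  LieGroupExtension.topologicalSpaceModel LieGroupExtension.isTopologicalAddGroup
  LieGroupExtension.continuousSMul LieGroupExtension.polynormableSpace LieGroupExtension.t2Space
  LieGroupExtension.group LieGroupExtension.topologicalSpace LieGroupExtension.chartedSpace
  LieGroupExtension.isLieGroup

variable (𝕜 : Type*) [RCLike 𝕜]
  (E : Type uE) [AddCommGroup E] [Module 𝕜 E] [TopologicalSpace E]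
  (F : Type uF) [AddCommGroup F] [Module 𝕜 F] [TopologicalSpace F]
  (G : Type uG) [Group G] [TopologicalSpace G] [ChartedSpace E G]
  (N : Type uN) [Group N] [TopologicalSpace N] [ChartedSpace F N]

variable {𝕜 E F G N} in
/-- Equivalence of extensions: a Lie group morphism inducing the identity on `N` and on `G`. -/
def LieGroupExtension.Equivalent (X Y : LieGroupExtension 𝕜 E F G N) : Prop :=
  ∃ φ : X.Total →* Y.Total, MSmoothOn 𝕜 X.Model Y.Model φ univ ∧
    (∀ n, φ (X.ι n) = Y.ι n) ∧ ∀ x, Y.q (φ x) = X.q x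

/-- `Ext(G, N)`: the equivalence classes of Lie group extensions of `G` by `N`. -/
def LieExt : Type _ :=
  Quot (LieGroupExtension.Equivalent (𝕜 := 𝕜) (E := E) (F := F) (G := G) (N := N))

variable {𝕜 E F G N}

/-- `σ` is a normalized section of `q` that is smooth in an identity neighbourhood. -/
structure LieGroupExtension.IsSection (X : LieGroupExtension 𝕜 E F G N) (σ : G → X.Total) :
    Prop where
  isC1 : IsC1 𝕜 E X.Model σ
  q_apply : ∀ g, X.q (σ g) = g

/-- The extension corresponds to the kernel `[S]`: for a normalized locally smooth section `σ`, the
map `S'(g)(n) = σ(g) n σ(g)⁻¹` satisfies `[S'] = [S]`. -/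
def LieGroupExtension.CorrespondsTo (X : LieGroupExtension 𝕜 E F G N) (S : G → MulAut N) : Prop :=
  ∃ (σ : G → X.Total) (S' : G → MulAut N), X.IsSection σ ∧
    (∀ g n, X.ι (S' g n) = σ g * X.ι n * (σ g)⁻¹) ∧ OuterEquiv 𝕜 E F S S'

variable (𝕜 E F) in
/-- `Ext(G, N)_[S]`: the classes of extensions of `G` by `N` corresponding to `[S]`. -/
def ExtKernel (S : G → MulAut N) : Set (LieExt 𝕜 E F G N) :=
  {c | ∃ X : LieGroupExtension 𝕜 E F G N, Quot.mk _ X = c ∧ X.CorrespondsTo S}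

end Extensions

/-! Both parts reduce to one question: is there a factor set ω for `S` with d_S ω = 1, and how
smooth is it? The class of `S` vanishes exactly when such an ω exists in C²_ss, resp. C²_s: if d_S ω
= d_S β with β central, replace ω by ωβ⁻¹ (`charClassSs_eq_one_iff`, `charClassS_eq_one_iff`). It
remains to see that extensions for [S] exist exactly when there is such an ω in C²_ss
(`extKernel_nonempty_iff`).

Given an extension, correct the section by the map h relating S' to `S`, so that conjugation by the
new section τ induces `S` itself, and let ω(g, g') be τ(g)τ(g')τ(gg')⁻¹. Associativity gives d_S ω =
1. Since ω(g, x) ω(gxg⁻¹, g)⁻¹ equals τ(g)τ(x)τ(g)⁻¹τ(gxg⁻¹)⁻¹, in which only x varies, ω lies in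
C²_ss automatically (`LieGroupExtension.exists_factorSet`).

Conversely, ω turns N × G into a group by (n, g)(n', g') = (n S(g)(n') ω(g, g'), gg'), whose
operations are smooth only near the identity. Such a local structure extends by left translation to
a Lie group as soon as every conjugation is smooth near the identity (`LocalLieGroup`). Conjugation
by (1, g) involves exactly the twist x ↦ ω(g, x) ω(gxg⁻¹, g)⁻¹, so the C²_ss condition is what is
needed (`FactorSystem.locallySmooth_conj_sec_iff`).

When G is connected, the elements g for which conjugation by (1, g) and by (1, g⁻¹) is smooth near
the identity form an open subgroup, hence all of G. A factor set in C²_s with trivial coboundary is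
then already in C²_ss (`FactorSystem.isC2ss_of_connected`), which gives the second part. -/

set_option linter.unusedSectionVars false

/-! ### Locality of smoothness. -/

section Manifolds

variable {𝕜 : Type*} [RCLike 𝕜]
  {E : Type*} [AddCommGroup E] [Module 𝕜 E] [TopologicalSpace E]
  {E' : Type*} [AddCommGroup E'] [Module 𝕜 E'] [TopologicalSpace E']
  {M : Type*} [TopologicalSpace M] [ChartedSpace E M]
  {M' : Type*} [TopologicalSpace M'] [ChartedSpace E' M']

/-- Smoothness on a set is a local property. -/
theorem MSmoothOn.of_local [IsTopologicalAddGroup E] [ContinuousSMul 𝕜 E] [T2Space E']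
    {f : M → M'} {W : Set M}
    (h : ∀ x ∈ W, ∃ O, IsOpen O ∧ x ∈ O ∧ MSmoothOn 𝕜 E E' f O) : MSmoothOn 𝕜 E E' f W := by
  refine ⟨fun x hx => ?_, fun e he e' he' n => IsCk.of_local ?_⟩
  · obtain ⟨O, hO, hxO, hf⟩ := h x hx
    exact (hf.1.continuousAt (hO.mem_nhds hxO)).continuousWithinAt
  · rintro v ⟨hv, hvW, hv'⟩
    obtain ⟨O, hO, hxO, hf⟩ := h _ hvW
    exact ⟨e.target ∩ e.symm ⁻¹' (O ∩ f ⁻¹' e'.source),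
      e.symm.isOpen_inter_preimage (hf.1.isOpen_inter_preimage hO e'.open_source),
      ⟨hv, hxO, hv'⟩, hf.2 e he e' he' n⟩

end Manifolds

/-! ### From a local Lie group structure to a Lie group. -/

section Globalization

variable (𝕜 : Type*) [RCLike 𝕜]
  (E : Type*) [AddCommGroup E] [Module 𝕜 E] [TopologicalSpace E]
  (P : Type*) [One P] [TopologicalSpace P] [ChartedSpace E P]
  (Q : Type*) [Group Q]

/-- A group `Q` identified with a manifold `P` such that near the identity the operations are
smooth: left translations are smooth where they stay inside a neighbourhood `nhd` of the identity,
and multiplication, inversion and all conjugations are smooth near the identity. -/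
structure LocalLieGroup where
  coord : Q ≃ P
  coord_one : coord 1 = 1
  nhd : Set P
  isOpen_nhd : IsOpen nhd
  one_mem : 1 ∈ nhd
  isOpen_translate : ∀ z, IsOpen {p | p ∈ nhd ∧ coord (z * coord.symm p) ∈ nhd}
  smooth_translate : ∀ z, MSmoothOn 𝕜 E E (fun p => coord (z * coord.symm p))
    {p | p ∈ nhd ∧ coord (z * coord.symm p) ∈ nhd}
  smooth_mul : LocallySmooth 𝕜 (E × E) E
    (fun p : P × P => coord (coord.symm p.1 * coord.symm p.2))
  smooth_inv : LocallySmooth 𝕜 E E (fun p => coord (coord.symm p)⁻¹)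
  smooth_conj : ∀ z, LocallySmooth 𝕜 E E (fun p => coord (z * coord.symm p * z⁻¹))

namespace LocalLieGroup

variable {𝕜 E P Q}

/-- The group underlying a local Lie group, with its Lie group structure. -/
def Global (_ : LocalLieGroup 𝕜 E P Q) : Type _ := Q

variable (D : LocalLieGroup 𝕜 E P Q)

instance : Group D.Global := inferInstanceAs (Group Q)

/-- The identification of the global group with the manifold of coordinates. -/
def toCoord : D.Global ≃ P := D.coord

theorem toCoord_one : D.toCoord 1 = 1 := D.coord_one

/-- A set is open when all its left translates are open near the identity. -/
instance : TopologicalSpace D.Global where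
  IsOpen V := ∀ x, IsOpen {p | p ∈ D.nhd ∧ x * D.toCoord.symm p ∈ V}
  isOpen_univ x := by simpa using D.isOpen_nhd
  isOpen_inter V V' hV hV' x := by
    convert (hV x).inter (hV' x) using 1
    ext p
    simp only [mem_inter_iff, mem_ofPred_eq]
    tauto
  isOpen_sUnion C hC x := by
    have : {p | p ∈ D.nhd ∧ x * D.toCoord.symm p ∈ ⋃₀ C} =
        ⋃ V ∈ C, {p | p ∈ D.nhd ∧ x * D.toCoord.symm p ∈ V} := by
      ext p
      simp only [mem_iUnion, mem_ofPred_eq, mem_sUnion]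
      tauto
    rw [this]
    exact isOpen_biUnion fun V hV => hC V hV x

theorem isOpen_iff {V : Set D.Global} :
    IsOpen V ↔ ∀ x, IsOpen {p | p ∈ D.nhd ∧ x * D.toCoord.symm p ∈ V} := Iff.rfl

theorem continuous_translate (a : D.Global) : Continuous fun x : D.Global => a * x := by
  refine ⟨fun V hV => D.isOpen_iff.2 fun x => ?_⟩
  simpa only [mem_preimage, mul_assoc] using D.isOpen_iff.1 hV (a * x)

/-- Left translation as a homeomorphism. -/
def translate (a : D.Global) : D.Global ≃ₜ D.Global where
  toEquiv := Equiv.mulLeft a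
  continuous_toFun := D.continuous_translate a
  continuous_invFun := D.continuous_translate a⁻¹

theorem isOpen_coord_preimage : IsOpen (D.toCoord ⁻¹' D.nhd) :=
  D.isOpen_iff.2 D.isOpen_translate

theorem smooth_toCoord_translate (z : D.Global) :
    MSmoothOn 𝕜 E E (fun p => D.toCoord (z * D.toCoord.symm p))
      {p | p ∈ D.nhd ∧ D.toCoord (z * D.toCoord.symm p) ∈ D.nhd} :=
  D.smooth_translate z

/-- The coordinates near the identity. -/
def coordNearOne : OpenPartialHomeomorph D.Global P where
  toFun := D.toCoord
  invFun := D.toCoord.symm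
  source := D.toCoord ⁻¹' D.nhd
  target := D.nhd
  map_source' _ h := h
  map_target' p h := by simpa using h
  left_inv' x _ := D.toCoord.symm_apply_apply x
  right_inv' p _ := D.toCoord.apply_symm_apply p
  open_source := D.isOpen_coord_preimage
  open_target := D.isOpen_nhd
  continuousOn_toFun := by
    -- Seen from x, the coordinate map becomes p ↦ coord(x · p), which is continuous on the open set
    -- where it stays inside `nhd`.
    refine (continuousOn_open_iff D.isOpen_coord_preimage).2 fun V hV => D.isOpen_iff.2 fun x => ?_
    convert (D.smooth_toCoord_translate x).1.isOpen_inter_preimage (D.isOpen_translate x) hV using 1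
    ext p
    simp only [mem_preimage, mem_inter_iff, mem_ofPred_eq]
    tauto
  continuousOn_invFun := by
    refine (continuousOn_open_iff D.isOpen_nhd).2 fun V hV => ?_
    convert D.isOpen_iff.1 hV 1 using 1
    ext p
    simp

theorem coordNearOne_source : D.coordNearOne.source = D.toCoord ⁻¹' D.nhd := rfl

theorem coordNearOne_target : D.coordNearOne.target = D.nhd := rfl

/-- The chart around `x` obtained by left translation from a chart of `P`. -/
def translatedChart (x : D.Global) (e : OpenPartialHomeomorph P E) :
    OpenPartialHomeomorph D.Global E :=
  ((D.translate x).symm.toOpenPartialHomeomorph.trans D.coordNearOne).trans e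

theorem translatedChart_apply (x : D.Global) (e : OpenPartialHomeomorph P E) (y : D.Global) :
    D.translatedChart x e y = e (D.toCoord (x⁻¹ * y)) := rfl

theorem translatedChart_symm_apply (x : D.Global) (e : OpenPartialHomeomorph P E) (v : E) :
    (D.translatedChart x e).symm v = x * D.toCoord.symm (e.symm v) := rfl

theorem mem_translatedChart_source {x : D.Global} {e : OpenPartialHomeomorph P E} {y : D.Global} :
    y ∈ (D.translatedChart x e).source ↔
      D.toCoord (x⁻¹ * y) ∈ D.nhd ∧ D.toCoord (x⁻¹ * y) ∈ e.source := by
  simp only [translatedChart, OpenPartialHomeomorph.trans_source, mem_inter_iff, mem_preimage,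
    Homeomorph.toOpenPartialHomeomorph_source, mem_univ, true_and, coordNearOne_source]
  rfl

theorem mem_translatedChart_target {x : D.Global} {e : OpenPartialHomeomorph P E} {v : E} :
    v ∈ (D.translatedChart x e).target ↔ v ∈ e.target ∧ e.symm v ∈ D.nhd := by
  simp only [translatedChart, OpenPartialHomeomorph.trans_target, mem_inter_iff, mem_preimage,
    Homeomorph.toOpenPartialHomeomorph_target, mem_univ, and_true, coordNearOne_target, preimage_univ]

/-- Every chart of `P` may be translated by every element, so left translations permute the atlas
and each change of charts is the expression of a left translation. -/
instance : ChartedSpace E D.Global where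
  atlas := {c | ∃ x, ∃ e ∈ atlas E P, D.translatedChart x e = c}
  chartAt x := D.translatedChart x (chartAt E 1)
  mem_chart_source x := by
    rw [mem_translatedChart_source, inv_mul_cancel, toCoord_one]
    exact ⟨D.one_mem, mem_chart_source E 1⟩
  chart_mem_atlas x := ⟨x, _, chart_mem_atlas E 1, rfl⟩

/-- Between charts based at x and at y, translation by a reads as left multiplication by y⁻¹ax in
the original coordinates, which is smooth where it stays in `nhd`. -/
theorem mSmoothOn_translate (a : D.Global) :
    MSmoothOn 𝕜 E E (fun x : D.Global => a * x) univ := by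
  refine ⟨(D.continuous_translate a).continuousOn, ?_⟩
  rintro _ ⟨x, e, he, rfl⟩ _ ⟨y, e', he', rfl⟩ n
  have h := (D.smooth_toCoord_translate (y⁻¹ * (a * x))).2 e he e' he' n
  have heq : (D.translatedChart y e' ∘ (fun x => a * x) ∘ (D.translatedChart x e).symm) =
      e' ∘ (fun p => D.toCoord (y⁻¹ * (a * x) * D.toCoord.symm p)) ∘ e.symm := by
    funext v
    simp only [Function.comp, translatedChart_apply, translatedChart_symm_apply, mul_assoc]
  rw [heq]
  refine h.mono ?_
  rintro v ⟨hv, -, hv'⟩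
  rw [mem_translatedChart_target] at hv
  rw [mem_preimage, mem_translatedChart_source, translatedChart_symm_apply] at hv'
  simp only [← mul_assoc] at hv'
  exact ⟨hv.1, ⟨hv.2, by simpa only [mul_assoc] using hv'.1⟩,
    by simpa only [mem_preimage, mul_assoc] using hv'.2⟩

instance : IsSmoothManifold 𝕜 E D.Global where
  compat c hc c' hc' n := by
    -- A change of charts is translation by 1 written in two charts.
    have h := (D.mSmoothOn_translate 1).2 c hc c' hc' n
    simp only [one_mul] at h
    exact h.mono fun v hv => ⟨hv.1, mem_univ _, hv.2⟩

theorem mSmoothOn_toCoord : MSmoothOn 𝕜 E E D.toCoord (D.toCoord ⁻¹' D.nhd) := by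
  refine ⟨D.coordNearOne.continuousOn, ?_⟩
  rintro _ ⟨x, e, he, rfl⟩ e' he' n
  refine ((D.smooth_toCoord_translate x).2 e he e' he' n).mono ?_
  rintro v ⟨hv, hv'⟩
  rw [mem_translatedChart_target] at hv
  exact ⟨hv.1, ⟨hv.2, hv'.1⟩, hv'.2⟩

theorem mSmoothOn_toCoord_symm : MSmoothOn 𝕜 E E D.toCoord.symm D.nhd := by
  refine ⟨D.coordNearOne.symm.continuousOn, ?_⟩
  rintro e he _ ⟨y, e', he', rfl⟩ n
  refine ((D.smooth_toCoord_translate y⁻¹).2 e he e' he' n).mono ?_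
  rintro v ⟨hv, hv', hv''⟩
  rw [mem_preimage, mem_translatedChart_source] at hv''
  exact ⟨hv, ⟨hv', hv''.1⟩, hv''.2⟩

theorem locallySmooth_toCoord : LocallySmooth 𝕜 E E D.toCoord :=
  ⟨_, D.isOpen_coord_preimage, by simpa [toCoord_one] using D.one_mem, D.mSmoothOn_toCoord⟩

theorem locallySmooth_toCoord_symm : LocallySmooth 𝕜 E E D.toCoord.symm :=
  ⟨_, D.isOpen_nhd, D.one_mem, D.mSmoothOn_toCoord_symm⟩

variable [IsTopologicalAddGroup E] [ContinuousSMul 𝕜 E] [PolynormableSpace 𝕜 E] [T2Space E]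

theorem locallySmooth_mul :
    LocallySmooth 𝕜 (E × E) E (fun p : D.Global × D.Global => p.1 * p.2) := by
  have h1 : LocallySmooth 𝕜 (E × E) E (fun p : D.Global × D.Global => D.toCoord p.1) :=
    D.locallySmooth_toCoord.comp (mSmoothOn_fst univ).locallySmooth rfl
  have h2 : LocallySmooth 𝕜 (E × E) E (fun p : D.Global × D.Global => D.toCoord p.2) :=
    D.locallySmooth_toCoord.comp (mSmoothOn_snd univ).locallySmooth rfl
  have h3 : LocallySmooth 𝕜 (E × E) E (fun p : D.Global × D.Global => D.toCoord (p.1 * p.2)) := by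
    have h : LocallySmooth 𝕜 (E × E) E
      (fun p : P × P => D.toCoord (D.toCoord.symm p.1 * D.toCoord.symm p.2)) := D.smooth_mul
    simpa using h.comp (h1.prodMk h2) (Prod.ext D.toCoord_one D.toCoord_one)
  simpa using D.locallySmooth_toCoord_symm.comp h3 (by simp [toCoord_one])

theorem locallySmooth_inv : LocallySmooth 𝕜 E E (fun x : D.Global => x⁻¹) := by
  have h3 : LocallySmooth 𝕜 E E (fun x : D.Global => D.toCoord x⁻¹) := by
    have h : LocallySmooth 𝕜 E E (fun p : P => D.toCoord (D.toCoord.symm p)⁻¹) := D.smooth_inv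
    simpa using h.comp D.locallySmooth_toCoord D.toCoord_one
  simpa using D.locallySmooth_toCoord_symm.comp h3 (by simp [toCoord_one])

theorem locallySmooth_conj (z : D.Global) :
    LocallySmooth 𝕜 E E (fun x : D.Global => z * x * z⁻¹) := by
  have h3 : LocallySmooth 𝕜 E E (fun x : D.Global => D.toCoord (z * x * z⁻¹)) := by
    have h : LocallySmooth 𝕜 E E (fun p : P => D.toCoord (z * D.toCoord.symm p * z⁻¹)) :=
      D.smooth_conj z
    simpa using h.comp D.locallySmooth_toCoord D.toCoord_one
  simpa using D.locallySmooth_toCoord_symm.comp h3 (by simp [toCoord_one])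

/-- Left translations are smooth by construction; right translations are not known to be, and
conjugations near 1 take their place. -/
instance : IsLieGroup 𝕜 E D.Global where
  smooth_mul := by
    refine MSmoothOn.of_local fun p _ => ?_
    obtain ⟨x, y⟩ := p
    -- Near (x, y), write pq = xy · (y⁻¹(x⁻¹p)y) · (y⁻¹q): both x⁻¹p and y⁻¹q are near 1, where
    -- conjugation by y⁻¹ and multiplication are smooth.
    have hc := (D.locallySmooth_conj y⁻¹).comp
      (mSmoothOn_fst (E := E) (E' := E) (M := D.Global) (M' := D.Global) univ).locallySmooth rfl
    have hm := D.locallySmooth_mul.comp (hc.prodMk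
      (mSmoothOn_snd (E := E) (E' := E) (M := D.Global) (M' := D.Global) univ).locallySmooth)
      (by simp [Prod.ext_iff])
    obtain ⟨O, hO, h1, hm⟩ := (D.mSmoothOn_translate (x * y)).locallySmooth_comp hm
    have hl : MSmoothOn 𝕜 (E × E) (E × E)
        (fun p : D.Global × D.Global => (x⁻¹ * p.1, y⁻¹ * p.2)) univ :=
      ((D.mSmoothOn_translate x⁻¹).comp (mSmoothOn_fst univ) isOpen_univ isOpen_univ
        (mapsTo_univ _ _)).prodMk
      ((D.mSmoothOn_translate y⁻¹).comp (mSmoothOn_snd univ) isOpen_univ isOpen_univ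
        (mapsTo_univ _ _))
    have hpre := hl.1.isOpen_inter_preimage isOpen_univ hO
    refine ⟨_, hpre, ⟨mem_univ _, ?_⟩, (hm.comp (hl.mono inter_subset_left) hpre hO
      fun _ h => h.2).congr hpre fun p _ => ?_⟩
    · simpa [Prod.one_eq_mk] using h1
    · simp only [Function.comp]
      group
  smooth_inv := by
    refine MSmoothOn.of_local fun x _ => ?_
    -- Near x, write p⁻¹ = x⁻¹ · (x (x⁻¹p)⁻¹ x⁻¹).
    have hm := (D.locallySmooth_conj x).comp D.locallySmooth_inv (by simp)
    obtain ⟨O, hO, h1, hm⟩ := (D.mSmoothOn_translate x⁻¹).locallySmooth_comp hm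
    have hl := D.mSmoothOn_translate x⁻¹
    have hpre := hl.1.isOpen_inter_preimage isOpen_univ hO
    refine ⟨_, hpre, ⟨mem_univ _, ?_⟩, (hm.comp (hl.mono inter_subset_left) hpre hO
      fun _ h => h.2).congr hpre fun p _ => ?_⟩
    · simpa using h1
    · simp only [Function.comp]
      group

end LocalLieGroup

end Globalization

/-! ### Smooth maps into Lie groups. -/

section LieGroupCalculus

theorem IsLieGroup.isTopologicalGroup (𝕜 : Type*) [RCLike 𝕜] (F : Type*) [AddCommGroup F]
    [Module 𝕜 F] [TopologicalSpace F] (N : Type*) [Group N] [TopologicalSpace N]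
    [ChartedSpace F N] [h : IsLieGroup 𝕜 F N] : IsTopologicalGroup N where
  continuous_mul := continuousOn_univ.1 h.smooth_mul.1
  continuous_inv := continuousOn_univ.1 h.smooth_inv.1

variable {𝕜 : Type*} [RCLike 𝕜]
  {E : Type*} [AddCommGroup E] [Module 𝕜 E] [TopologicalSpace E] [IsTopologicalAddGroup E]
  [ContinuousSMul 𝕜 E]
  {F : Type*} [AddCommGroup F] [Module 𝕜 F] [TopologicalSpace F] [IsTopologicalAddGroup F]
  [ContinuousSMul 𝕜 F] [PolynormableSpace 𝕜 F] [T2Space F]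
  {F' : Type*} [AddCommGroup F'] [Module 𝕜 F'] [TopologicalSpace F'] [IsTopologicalAddGroup F']
  [ContinuousSMul 𝕜 F'] [PolynormableSpace 𝕜 F'] [T2Space F']
  {M : Type*} [TopologicalSpace M] [ChartedSpace E M]
  {N : Type*} [Group N] [TopologicalSpace N] [ChartedSpace F N] [IsLieGroup 𝕜 F N]
  {G : Type*} [Group G] [TopologicalSpace G] [ChartedSpace F' G] [IsLieGroup 𝕜 F' G]

theorem MSmoothOn.mul {f g : M → N} {W : Set M} (hf : MSmoothOn 𝕜 E F f W)
    (hg : MSmoothOn 𝕜 E F g W) (hW : IsOpen W) : MSmoothOn 𝕜 E F (fun x => f x * g x) W :=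
  (IsLieGroup.smooth_mul (𝕜 := 𝕜) (E := F) (G := N)).comp (hf.prodMk hg) hW isOpen_univ
    (mapsTo_univ _ _)

theorem MSmoothOn.inv {f : M → N} {W : Set M} (hf : MSmoothOn 𝕜 E F f W) (hW : IsOpen W) :
    MSmoothOn 𝕜 E F (fun x => (f x)⁻¹) W :=
  (IsLieGroup.smooth_inv (𝕜 := 𝕜) (E := F) (G := N)).comp hf hW isOpen_univ (mapsTo_univ _ _)

theorem locallySmooth_const [One M] (c : N) : LocallySmooth 𝕜 E F (fun _ : M => c) :=
  (mSmoothOn_const c _).locallySmooth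

theorem LocallySmooth.fst [One M] {f : M → N × G} (hf : LocallySmooth 𝕜 E (F × F') f) :
    LocallySmooth 𝕜 E F (fun x => (f x).1) :=
  (mSmoothOn_fst (𝕜 := 𝕜) (E := F) (M := N) (E' := F') (M' := G) univ).locallySmooth_comp hf

theorem LocallySmooth.snd [One M] {f : M → N × G} (hf : LocallySmooth 𝕜 E (F × F') f) :
    LocallySmooth 𝕜 E F' (fun x => (f x).2) :=
  (mSmoothOn_snd (𝕜 := 𝕜) (E := F) (M := N) (E' := F') (M' := G) univ).locallySmooth_comp hf

variable (𝕜 F N) in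
theorem locallySmooth_id : LocallySmooth 𝕜 F F (fun x : N => x) :=
  (mSmoothOn_id (𝕜 := 𝕜) (E := F) (M := N) univ).locallySmooth

theorem IsLieGroup.mSmoothOn_mul_left (a : N) : MSmoothOn 𝕜 F F (fun x : N => a * x) univ :=
  (mSmoothOn_const a _).mul (mSmoothOn_id univ) isOpen_univ

/-- A homomorphism of Lie groups that is smooth near the identity is smooth. -/
theorem MonoidHom.mSmoothOn_of_locallySmooth (φ : N →* G) (h : LocallySmooth 𝕜 F F' φ) :
    MSmoothOn 𝕜 F F' φ univ := by
  refine MSmoothOn.of_local fun x _ => ?_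
  -- Near x, φ(p) = φ(x) φ(x⁻¹p).
  obtain ⟨O, hO, h1, hm⟩ := (IsLieGroup.mSmoothOn_mul_left (φ x)).locallySmooth_comp h
  have hl := IsLieGroup.mSmoothOn_mul_left (𝕜 := 𝕜) (F := F) x⁻¹
  have hpre := hl.1.isOpen_inter_preimage isOpen_univ hO
  refine ⟨_, hpre, ⟨mem_univ _, by simpa using h1⟩, (hm.comp (hl.mono inter_subset_left) hpre hO
    fun _ h => h.2).congr hpre fun p _ => ?_⟩
  simp

end LieGroupCalculus

/-! ### The crossed product group of a factor system. -/

section CrossedProducts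

/-- A factor system: normalized maps `S` and `ω` with `δ_S = C_N ∘ ω` and `d_S ω = 1`. -/
structure FactorSystem (G N : Type*) [Group G] [Group N] where
  S : G → MulAut N
  ω : G → G → N
  map_one : S 1 = 1
  one_left : ∀ g, ω 1 g = 1
  one_right : ∀ g, ω g 1 = 1
  delta_eq : ∀ g g', deltaMap S g g' = MulAut.conj (ω g g')
  dCochain_eq : ∀ a b c, dCochain S ω a b c = 1

namespace FactorSystem

variable {G N : Type*} [Group G] [Group N]

/-- The set `N × G` with the multiplication
`(n, g) (n', g') = (n S(g)(n') ω(g, g'), g g')`. -/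
def Crossed (_ : FactorSystem G N) : Type _ := N × G

variable (A : FactorSystem G N)

/-- The coordinates of a crossed product. -/
def coord : A.Crossed ≃ N × G := Equiv.refl _

instance : Group A.Crossed :=
  letI : Mul A.Crossed := ⟨fun x y => A.coord.symm
    ((A.coord x).1 * A.S (A.coord x).2 (A.coord y).1 * A.ω (A.coord x).2 (A.coord y).2,
      (A.coord x).2 * (A.coord y).2)⟩
  letI : One A.Crossed := ⟨A.coord.symm 1⟩
  letI : Inv A.Crossed := ⟨fun x => A.coord.symm
    ((A.S (A.coord x).2⁻¹ (A.coord x).1 * A.ω (A.coord x).2⁻¹ (A.coord x).2)⁻¹, (A.coord x).2⁻¹)⟩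
  Group.ofLeftAxioms
    (by
      rintro ⟨n, g⟩ ⟨n', g'⟩ ⟨n'', g''⟩
      refine Prod.ext ?_ (mul_assoc _ _ _)
      change n * A.S g n' * A.ω g g' * A.S (g * g') n'' * A.ω (g * g') g'' =
        n * A.S g (n' * A.S g' n'' * A.ω g' g'') * A.ω g (g' * g'')
      -- As d_S ω = 1, this reads S(g)(ω(g', g'')) ω(g, g'g'') = ω(g, g') ω(gg', g''). Together with
      -- S(g)S(g') = C_N(ω(g, g')) S(gg') it gives associativity.
      have h := dCochain_rel A.S A.ω g g' g''
      rw [A.dCochain_eq, one_mul] at h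
      rw [map_mul, map_mul, mul_assoc n (_ * _), mul_assoc (_ * _) (A.S g (A.ω g' g'')), h,
        conj_lift_apply A.delta_eq]
      group)
    (by
      rintro ⟨n, g⟩
      refine Prod.ext ?_ (one_mul _)
      change 1 * A.S 1 n * A.ω 1 g = n
      simp [A.map_one, A.one_left])
    (by
      rintro ⟨n, g⟩
      refine Prod.ext ?_ (inv_mul_cancel g)
      change (A.S g⁻¹ n * A.ω g⁻¹ g)⁻¹ * A.S g⁻¹ n * A.ω g⁻¹ g = 1
      group)

theorem coord_one : A.coord 1 = 1 := rfl

theorem coord_mul (x y : A.Crossed) : A.coord (x * y) =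
    ((A.coord x).1 * A.S (A.coord x).2 (A.coord y).1 * A.ω (A.coord x).2 (A.coord y).2,
      (A.coord x).2 * (A.coord y).2) := rfl

/-- The inclusion of `N`. -/
def incl : N →* A.Crossed where
  toFun n := A.coord.symm (n, 1)
  map_one' := rfl
  map_mul' n n' := A.coord.injective (by simp [coord_mul, A.map_one, A.one_left])

/-- The projection to `G`. -/
def proj : A.Crossed →* G where
  toFun x := (A.coord x).2
  map_one' := rfl
  map_mul' _ _ := rfl

/-- The canonical section. -/
def sec (g : G) : A.Crossed := A.coord.symm (1, g)

theorem coord_incl (n : N) : A.coord (A.incl n) = (n, 1) := rfl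

theorem coord_sec (g : G) : A.coord (A.sec g) = (1, g) := rfl

theorem incl_of_proj_eq_one {x : A.Crossed} (hx : A.proj x = 1) :
    A.incl (A.coord x).1 = x :=
  A.coord.injective (Prod.ext rfl hx.symm)

theorem sec_mul_incl (g : G) (n : N) : A.sec g * A.incl n = A.incl (A.S g n) * A.sec g :=
  A.coord.injective (by simp [coord_mul, coord_incl, coord_sec, A.one_left, A.one_right])

theorem sec_mul_sec (g g' : G) : A.sec g * A.sec g' = A.incl (A.ω g g') * A.sec (g * g') :=
  A.coord.injective (by simp [coord_mul, coord_incl, coord_sec, A.one_left])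

theorem incl_mul_sec (n : N) (g : G) : A.incl n * A.sec g = A.coord.symm (n, g) :=
  A.coord.injective (by simp [coord_mul, coord_incl, coord_sec, A.one_left])

theorem conj_incl (m : N) (p : N × G) :
    A.coord (A.incl m * A.coord.symm p * (A.incl m)⁻¹) = (m * p.1 * A.S p.2 m⁻¹, p.2) := by
  simp [coord_mul, ← map_inv A.incl, coord_incl, A.one_left, A.one_right, A.map_one,
    -map_inv]

/-- The twist from the definition of C²_ss appears here as the N-component of a conjugation. -/
theorem conj_sec (g : G) (p : N × G) :
    A.coord (A.sec g * A.coord.symm p * (A.sec g)⁻¹) =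
      (A.S g p.1 * (A.ω g p.2 * (A.ω (g * p.2 * g⁻¹) g)⁻¹), g * p.2 * g⁻¹) := by
  rw [eq_comm, ← A.coord.symm_apply_eq, eq_mul_inv_iff_mul_eq]
  exact A.coord.injective (by simp [coord_mul, coord_sec, mul_assoc])

end FactorSystem

end CrossedProducts

/-! ### Smoothness near the identity in the crossed product. -/

section SmoothFactorSystems

namespace FactorSystem

section Local

variable {𝕜 : Type*} [RCLike 𝕜]
  {E : Type*} [AddCommGroup E] [Module 𝕜 E] [TopologicalSpace E] [IsTopologicalAddGroup E]
  [ContinuousSMul 𝕜 E] [PolynormableSpace 𝕜 E] [T2Space E]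
  {F : Type*} [AddCommGroup F] [Module 𝕜 F] [TopologicalSpace F] [IsTopologicalAddGroup F]
  [ContinuousSMul 𝕜 F] [PolynormableSpace 𝕜 F] [T2Space F]
  {G : Type*} [Group G] [TopologicalSpace G] [ChartedSpace E G] [IsLieGroup 𝕜 E G]
  {N : Type*} [Group N] [TopologicalSpace N] [ChartedSpace F N] [IsLieGroup 𝕜 F N]
  {A : FactorSystem G N}

theorem locallySmooth_action (hS : IsC1Aut 𝕜 E F A.S) :
    LocallySmooth 𝕜 (E × F) F (fun p : G × N => A.S p.1 p.2) := by
  obtain ⟨U, hU, h1, hs⟩ := hS.smooth_near_one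
  exact ⟨_, hU.prod isOpen_univ, ⟨h1, mem_univ _⟩, hs⟩

theorem locallySmooth_orbit (hS : IsC1Aut 𝕜 E F A.S) (m : N) :
    LocallySmooth 𝕜 E F (fun g : G => A.S g m) := by
  obtain ⟨U, hU, h1, hs⟩ := hS.smooth_near_one
  exact ⟨U, hU, h1, hs.comp ((mSmoothOn_id U).prodMk (mSmoothOn_const m U)) hU
    (hU.prod isOpen_univ) fun _ hx => ⟨hx, mem_univ _⟩⟩

theorem locallySmooth_conj_incl (hS : IsC1Aut 𝕜 E F A.S) (m : N) :
    LocallySmooth 𝕜 (F × E) (F × E)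
      (fun p : N × G => A.coord (A.incl m * A.coord.symm p * (A.incl m)⁻¹)) := by
  simp only [conj_incl]
  have h1 : LocallySmooth 𝕜 (F × E) F (fun p : N × G => p.1) :=
    (mSmoothOn_fst univ).locallySmooth
  have h2 : LocallySmooth 𝕜 (F × E) E (fun p : N × G => p.2) :=
    (mSmoothOn_snd univ).locallySmooth
  exact (((locallySmooth_const m).mul h1).mul ((locallySmooth_orbit hS m⁻¹).comp h2 rfl)).prodMk h2

/-- By `conj_sec`, the twist is the only ingredient of this conjugation that can fail to be smooth,
because each `S g` is a Lie automorphism. Restricting to {1} × G recovers the twist. -/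
theorem locallySmooth_conj_sec_iff (hS : IsC1Aut 𝕜 E F A.S) (g : G) :
    LocallySmooth 𝕜 (F × E) (F × E)
      (fun p : N × G => A.coord (A.sec g * A.coord.symm p * (A.sec g)⁻¹)) ↔
    LocallySmooth 𝕜 E F (fun x => A.ω g x * (A.ω (g * x * g⁻¹) g)⁻¹) := by
  simp only [conj_sec]
  constructor
  · intro h
    have hi : LocallySmooth 𝕜 E (F × E) (fun x : G => ((1 : N), x)) :=
      (locallySmooth_const 1).prodMk (locallySmooth_id 𝕜 E G)
    simpa using (h.comp hi rfl).fst
  · intro h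
    have h1 : LocallySmooth 𝕜 (F × E) F (fun p : N × G => p.1) :=
      (mSmoothOn_fst univ).locallySmooth
    have h2 : LocallySmooth 𝕜 (F × E) E (fun p : N × G => p.2) :=
      (mSmoothOn_snd univ).locallySmooth
    exact (((hS.isLieAut g).1.locallySmooth_comp h1).mul (h.comp h2 rfl)).prodMk
      (((locallySmooth_const g).mul h2).mul (locallySmooth_const g⁻¹))

/-- Conjugations compose and fix the identity, so their germs at the identity can be composed. -/
theorem locallySmooth_conj_mul {x y : A.Crossed}
    (hx : LocallySmooth 𝕜 (F × E) (F × E) (fun p : N × G => A.coord (x * A.coord.symm p * x⁻¹)))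
    (hy : LocallySmooth 𝕜 (F × E) (F × E) (fun p : N × G => A.coord (y * A.coord.symm p * y⁻¹))) :
    LocallySmooth 𝕜 (F × E) (F × E)
      (fun p : N × G => A.coord ((x * y) * A.coord.symm p * (x * y)⁻¹)) := by
  have h := hx.comp hy ?_
  · simpa [mul_assoc] using h
  · have : A.coord.symm 1 = 1 := rfl
    simp [this, coord_one]

/-- On a connected group, the factor set of a factor system that is smooth near the identity lies
in `C²_ss`. -/
theorem isC2ss_of_connected [ConnectedSpace G] (hS : IsC1Aut 𝕜 E F A.S) (hω : IsC2 𝕜 E F A.ω) :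
    IsC2ss 𝕜 E F A.ω := by
  refine ⟨hω, ?_⟩
  have := IsLieGroup.isTopologicalGroup 𝕜 E G
  -- Phrased through conjugations, the twist condition at g becomes multiplicative in g, up to a
  -- factor from N whose conjugation is always smooth near the identity.
  set K : G → Prop := fun g => LocallySmooth 𝕜 (F × E) (F × E)
    (fun p : N × G => A.coord (A.sec g * A.coord.symm p * (A.sec g)⁻¹)) with hK
  have hmul : ∀ g g', K g → K g' → K (g * g') := fun g g' h h' => by
    have e : A.sec (g * g') = A.incl (A.ω g g')⁻¹ * (A.sec g * A.sec g') := by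
      rw [sec_mul_sec, map_inv, inv_mul_cancel_left]
    simp only [hK, e]
    exact locallySmooth_conj_mul (locallySmooth_conj_incl hS _) (locallySmooth_conj_mul h h')
  have hone : K 1 := by
    refine (locallySmooth_conj_sec_iff hS _).2 ?_
    simpa [hω.one_left, hω.one_right] using locallySmooth_const (𝕜 := 𝕜) (E := E) (1 : N)
  let H : Subgroup G :=
    -- `K g` does not visibly pass to inverses, hence the symmetric condition.
    { carrier := {g | K g ∧ K g⁻¹}
      one_mem' := ⟨hone, by simpa using hone⟩
      mul_mem' := fun h h' => ⟨hmul _ _ h.1 h'.1, by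
        rw [mul_inv_rev]
        exact hmul _ _ h'.2 h.2⟩
      inv_mem' := fun h => ⟨h.2, by simpa using h.1⟩ }
  -- The twist is smooth in (g, x) jointly near (1, 1); fixing g close to 1 leaves a map of x that
  -- is smooth near 1.
  have hnear : ∀ᶠ g in 𝓝 (1 : G), K g := by
    have h1 : LocallySmooth 𝕜 (E × E) E (fun p : G × G => p.1) :=
      (mSmoothOn_fst univ).locallySmooth
    have h2 : LocallySmooth 𝕜 (E × E) E (fun p : G × G => p.2) :=
      (mSmoothOn_snd univ).locallySmooth
    obtain ⟨O, hO, h1O, hs⟩ := hω.locallySmooth.mul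
      (hω.locallySmooth.comp (((h1.mul h2).mul h1.inv).prodMk h1) (by simp)).inv
    have hc : Continuous fun g : G => (g, (1 : G)) := by fun_prop
    filter_upwards [(hO.preimage hc).mem_nhds h1O] with g hg
    refine (locallySmooth_conj_sec_iff hS _).2 ?_
    have hi : MSmoothOn 𝕜 E (E × E) (fun x : G => (g, x)) univ :=
      (mSmoothOn_const g _).prodMk (mSmoothOn_id _)
    have hpre := hi.1.isOpen_inter_preimage isOpen_univ hO
    exact ⟨_, hpre, ⟨mem_univ _, hg⟩, hs.comp (hi.mono inter_subset_left) hpre hO fun _ h => h.2⟩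
  have hH : (H : Set G) ∈ 𝓝 (1 : G) := by
    have hi : Tendsto (fun g : G => g⁻¹) (𝓝 1) (𝓝 1) := by
      simpa using (continuous_inv (G := G)).tendsto 1
    exact hnear.and (hi.eventually hnear)
  have hopen := H.isOpen_of_mem_nhds hH
  have huniv := IsClopen.eq_univ ⟨H.isClosed_of_isOpen hopen, hopen⟩ ⟨1, H.one_mem⟩
  intro g
  have hg : g ∈ (H : Set G) := huniv ▸ mem_univ g
  exact (locallySmooth_conj_sec_iff hS g).1 hg.1

/-- If u and gu both lie in U, then g = (gu)u⁻¹ is close to 1 as well, so for small U the pair (g,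
u) stays where ω is smooth, although g is arbitrary. This is what makes left translations of the
crossed product smooth in coordinates. -/
theorem exists_nhd (hω : IsC2 𝕜 E F A.ω) : ∃ U : Set G, IsOpen U ∧ 1 ∈ U ∧
    ∀ g, MSmoothOn 𝕜 E F (A.ω g) {u | u ∈ U ∧ g * u ∈ U} := by
  have := IsLieGroup.isTopologicalGroup 𝕜 E G
  obtain ⟨O, hO, h1, hs⟩ := hω.locallySmooth
  have hc : Continuous fun p : G × G => (p.1 * p.2⁻¹, p.2) := by fun_prop
  have hm : (fun p : G × G => (p.1 * p.2⁻¹, p.2)) ⁻¹' O ∈ 𝓝 ((1 : G), (1 : G)) :=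
    (hO.preimage hc).mem_nhds (by simpa [Prod.one_eq_mk] using h1)
  rw [nhds_prod_eq, mem_prod_same_iff] at hm
  obtain ⟨V, hV, hVO⟩ := hm
  obtain ⟨U, hUV, hU, h1U⟩ := mem_nhds_iff.1 hV
  refine ⟨U, hU, h1U, fun g => ?_⟩
  refine hs.comp (f := fun u => (g, u)) ((mSmoothOn_const g _).prodMk (mSmoothOn_id _))
    (hU.inter (hU.preimage (continuous_const_mul g))) hO fun u hu => ?_
  simpa using hVO (mk_mem_prod (hUV hu.2) (hUV hu.1))

/-- A smooth factor system makes the crossed product a local Lie group. -/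
noncomputable def localLieGroup (hS : IsC1Aut 𝕜 E F A.S) (hω : IsC2ss 𝕜 E F A.ω) :
    LocalLieGroup 𝕜 (F × E) (N × G) A.Crossed where
  coord := A.coord
  coord_one := rfl
  -- Only the G-coordinate is restricted: each `S g` is smooth on all of N, and keeping whole fibres
  -- gives smooth coordinates over all of q⁻¹(U).
  nhd := {p | p.2 ∈ (exists_nhd hω.toIsC2).choose}
  isOpen_nhd := (exists_nhd hω.toIsC2).choose_spec.1.preimage continuous_snd
  one_mem := (exists_nhd hω.toIsC2).choose_spec.2.1
  isOpen_translate z := by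
    have := IsLieGroup.isTopologicalGroup 𝕜 E G
    have hU := (exists_nhd hω.toIsC2).choose_spec.1
    exact (hU.preimage continuous_snd).inter
      (hU.preimage ((continuous_const_mul (A.coord z).2).comp continuous_snd))
  smooth_translate z := by
    have := IsLieGroup.isTopologicalGroup 𝕜 E G
    obtain ⟨hU, -, hs⟩ := (exists_nhd hω.toIsC2).choose_spec
    set U := (exists_nhd hω.toIsC2).choose
    set g := (A.coord z).2 with hg
    have hO : IsOpen {p : N × G | p.2 ∈ U ∧ g * p.2 ∈ U} := (hU.preimage continuous_snd).inter
      (hU.preimage ((continuous_const_mul g).comp continuous_snd))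
    have hO' : IsOpen {u | u ∈ U ∧ g * u ∈ U} := hU.inter (hU.preimage (continuous_const_mul g))
    have h1 : MSmoothOn 𝕜 (F × E) F (fun p : N × G => p.1) {p | p.2 ∈ U ∧ g * p.2 ∈ U} :=
      mSmoothOn_fst _
    have h2 : MSmoothOn 𝕜 (F × E) E (fun p : N × G => p.2) {p | p.2 ∈ U ∧ g * p.2 ∈ U} :=
      mSmoothOn_snd _
    exact ((((mSmoothOn_const (A.coord z).1 _).mul
      ((hS.isLieAut g).1.comp h1 hO isOpen_univ (mapsTo_univ _ _)) hO).mul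
      ((hs g).comp h2 hO hO' fun _ h => h) hO).prodMk ((mSmoothOn_const g _).mul h2 hO))
  smooth_mul := by
    have h1 : LocallySmooth 𝕜 ((F × E) × F × E) (F × E) (fun p : (N × G) × N × G => p.1) :=
      (mSmoothOn_fst univ).locallySmooth
    have h2 : LocallySmooth 𝕜 ((F × E) × F × E) (F × E) (fun p : (N × G) × N × G => p.2) :=
      (mSmoothOn_snd univ).locallySmooth
    exact ((h1.fst.mul ((locallySmooth_action hS).comp (h1.snd.prodMk h2.fst) rfl)).mul
      (hω.locallySmooth.comp (h1.snd.prodMk h2.snd) rfl)).prodMk (h1.snd.mul h2.snd)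
  smooth_inv := by
    have h1 : LocallySmooth 𝕜 (F × E) F (fun p : N × G => p.1) :=
      (mSmoothOn_fst univ).locallySmooth
    have h2 : LocallySmooth 𝕜 (F × E) E (fun p : N × G => p.2) :=
      (mSmoothOn_snd univ).locallySmooth
    exact (((locallySmooth_action hS).comp (h2.inv.prodMk h1) (Prod.ext inv_one rfl)).mul
      (hω.locallySmooth.comp (h2.inv.prodMk h2) (Prod.ext inv_one rfl))).inv.prodMk h2.inv
  smooth_conj z := by
    -- Every element is (n, 1)(1, g), so the two types of conjugation suffice; the C²_ss hypothesis
    -- enters through the second.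
    have hz : z = A.incl (A.coord z).1 * A.sec (A.coord z).2 := by
      rw [incl_mul_sec, Prod.mk.eta, A.coord.symm_apply_apply]
    rw [hz]
    exact locallySmooth_conj_mul (locallySmooth_conj_incl hS _)
      ((locallySmooth_conj_sec_iff hS _).2 (hω.locallySmooth_twist _))

end Local

end FactorSystem

end SmoothFactorSystems

/-! ### The crossed product as a Lie group extension. -/

section CrossedProductExtension

universe uE uF uG uN

namespace FactorSystem

variable {𝕜 : Type*} [RCLike 𝕜]
  {E : Type uE} [AddCommGroup E] [Module 𝕜 E] [TopologicalSpace E] [IsTopologicalAddGroup E]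
  [ContinuousSMul 𝕜 E] [PolynormableSpace 𝕜 E] [T2Space E]
  {F : Type uF} [AddCommGroup F] [Module 𝕜 F] [TopologicalSpace F] [IsTopologicalAddGroup F]
  [ContinuousSMul 𝕜 F] [PolynormableSpace 𝕜 F] [T2Space F]
  {G : Type uG} [Group G] [TopologicalSpace G] [ChartedSpace E G] [IsLieGroup 𝕜 E G]
  {N : Type uN} [Group N] [TopologicalSpace N] [ChartedSpace F N] [IsLieGroup 𝕜 F N]
  {A : FactorSystem G N} (hS : IsC1Aut 𝕜 E F A.S) (hω : IsC2ss 𝕜 E F A.ω)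

/-- The crossed product as a Lie group. -/
abbrev LieCrossed : Type _ := (localLieGroup hS hω).Global

/-- The inclusion of `N` in the Lie group `N × G`. -/
def inclHom : N →* LieCrossed hS hω := A.incl

/-- The projection of the Lie group `N × G` to `G`. -/
def projHom : LieCrossed hS hω →* G := A.proj

/-- The canonical section of the projection. -/
def canonicalSection (g : G) : LieCrossed hS hω := A.sec g

/-- The first coordinate on the Lie group `N × G`. -/
def fiberCoord (x : LieCrossed hS hω) : N := (A.coord x).1

/-- The neighbourhood of the identity of `G` over which the coordinates of the crossed product
are smooth. -/
def baseNhd : Set G := (exists_nhd hω.toIsC2).choose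

theorem isOpen_baseNhd : IsOpen (baseNhd hω) := (exists_nhd hω.toIsC2).choose_spec.1

theorem one_mem_baseNhd : 1 ∈ baseNhd hω := (exists_nhd hω.toIsC2).choose_spec.2.1

theorem mSmoothOn_inclHom : MSmoothOn 𝕜 F (F × E) (inclHom hS hω) univ :=
  (localLieGroup hS hω).mSmoothOn_toCoord_symm.comp (f := fun n : N => (n, (1 : G)))
    ((mSmoothOn_id _).prodMk (mSmoothOn_const 1 _)) isOpen_univ (localLieGroup hS hω).isOpen_nhd
    fun _ _ => one_mem_baseNhd hω

theorem mSmoothOn_section :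
    MSmoothOn 𝕜 E (F × E) (canonicalSection hS hω) (baseNhd hω) :=
  (localLieGroup hS hω).mSmoothOn_toCoord_symm.comp (f := fun g : G => ((1 : N), g))
    ((mSmoothOn_const 1 _).prodMk (mSmoothOn_id _)) (isOpen_baseNhd hω)
    (localLieGroup hS hω).isOpen_nhd fun _ hg => hg

/-- The coordinates control the projection only near the identity; being a homomorphism, it is then
smooth everywhere. -/
theorem mSmoothOn_projHom : MSmoothOn 𝕜 (F × E) E (projHom hS hω) univ :=
  (projHom hS hω).mSmoothOn_of_locallySmooth (localLieGroup hS hω).locallySmooth_toCoord.snd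

theorem mSmoothOn_fiberCoord :
    MSmoothOn 𝕜 (F × E) F (fiberCoord hS hω) (projHom hS hω ⁻¹' baseNhd hω) :=
  (mSmoothOn_fst univ).comp (localLieGroup hS hω).mSmoothOn_toCoord
    (localLieGroup hS hω).isOpen_coord_preimage isOpen_univ (mapsTo_univ _ _)

theorem projHom_section (g : G) : projHom hS hω (canonicalSection hS hω g) = g := rfl

theorem projHom_inclHom (n : N) : projHom hS hω (inclHom hS hω n) = 1 := rfl

theorem fiberCoord_inclHom (n : N) : fiberCoord hS hω (inclHom hS hω n) = n := rfl

theorem inclHom_fiberCoord {x : LieCrossed hS hω} (hx : projHom hS hω x = 1) :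
    inclHom hS hω (fiberCoord hS hω x) = x := A.incl_of_proj_eq_one hx

theorem section_mul_inclHom (g : G) (n : N) : canonicalSection hS hω g * inclHom hS hω n =
    inclHom hS hω (A.S g n) * canonicalSection hS hω g := A.sec_mul_incl g n

/-- The crossed product of a smooth factor system as a Lie group extension. -/
noncomputable def extension : LieGroupExtension 𝕜 E F G N where
  Model := F × E
  Total := LieCrossed hS hω
  ι := inclHom hS hω
  q := projHom hS hω
  ι_injective n n' h := congrArg (fiberCoord hS hω) h
  range_ι := by
    ext x
    rw [MonoidHom.mem_range, MonoidHom.mem_ker]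
    constructor
    · rintro ⟨n, rfl⟩
      exact projHom_inclHom hS hω n
    · exact fun h => ⟨_, inclHom_fiberCoord hS hω h⟩
  q_surjective g := ⟨canonicalSection hS hω g, rfl⟩
  ι_smooth := mSmoothOn_inclHom hS hω
  q_smooth := mSmoothOn_projHom hS hω
  locallyTrivial g₀ := by
    set s := canonicalSection hS hω g₀ with hs
    have hU := isOpen_baseNhd hω
    have hl : MSmoothOn 𝕜 E E (fun g : G => g₀⁻¹ * g) univ := IsLieGroup.mSmoothOn_mul_left g₀⁻¹
    have hU' : IsOpen {g | g₀⁻¹ * g ∈ baseNhd hω} :=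
      hU.preimage (continuousOn_univ.1 hl.1)
    have hq := mSmoothOn_projHom hS hω
    have hqU : IsOpen (projHom hS hω ⁻¹' {g | g₀⁻¹ * g ∈ baseNhd hω}) := by
      simpa using hq.1.isOpen_inter_preimage isOpen_univ hU'
    have hqV : IsOpen (projHom hS hω ⁻¹' baseNhd hω) := by
      simpa using hq.1.isOpen_inter_preimage isOpen_univ hU
    have hqs : ∀ x, projHom hS hω (s⁻¹ * x) = g₀⁻¹ * projHom hS hω x := fun x => by
      rw [map_mul, map_inv, hs, projHom_section]
    -- The section is smooth only near 1, so the trivialization near 1 is shifted by the fixed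
    -- element `s` over `g₀`. The coordinates put N on the left, but the bundle action is on the
    -- right; hence the factor from N comes last in Φ, and Ψ divides by the section on the left.
    refine ⟨_, hU', by simpa using one_mem_baseNhd hω,
      fun p => s * (canonicalSection hS hω (g₀⁻¹ * p.1) * inclHom hS hω p.2),
      fun x => fiberCoord hS hω
        ((canonicalSection hS hω (projHom hS hω (s⁻¹ * x)))⁻¹ * (s⁻¹ * x)), ?_, ?_, ?_, ?_, ?_⟩
    · have hW := hU'.prod (isOpen_univ (X := N))
      refine (mSmoothOn_const s _).mul (MSmoothOn.mul ?_ ?_ hW) hW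
      · exact (mSmoothOn_section hS hω).comp (hl.comp (mSmoothOn_fst _) hW isOpen_univ
          (mapsTo_univ _ _)) hW hU fun p hp => hp.1
      · exact (mSmoothOn_inclHom hS hω).comp (mSmoothOn_snd _) hW isOpen_univ (mapsTo_univ _ _)
    · have ht : MSmoothOn 𝕜 (F × E) (F × E) (fun x : LieCrossed hS hω => s⁻¹ * x)
          (projHom hS hω ⁻¹' {g | g₀⁻¹ * g ∈ baseNhd hω}) :=
        (IsLieGroup.mSmoothOn_mul_left s⁻¹).mono (subset_univ _)
      have h1 : MSmoothOn 𝕜 (F × E) (F × E)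
          (fun x => canonicalSection hS hω (projHom hS hω (s⁻¹ * x)))
          (projHom hS hω ⁻¹' {g | g₀⁻¹ * g ∈ baseNhd hω}) :=
        (mSmoothOn_section hS hω).comp (hq.comp ht hqU isOpen_univ (mapsTo_univ _ _)) hqU hU
          fun x hx => by
            rwa [hqs]
      -- The quotient by the section lies in the kernel of the projection, hence over `baseNhd`,
      -- where the fibre coordinate is smooth.
      refine (mSmoothOn_fiberCoord hS hω).comp ((h1.inv hqU).mul ht hqU) hqU hqV fun x _ => ?_
      rw [mem_preimage, map_mul, map_inv, projHom_section, inv_mul_cancel]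
      exact one_mem_baseNhd hω
    · intro g _ n
      constructor
      · rw [map_mul, map_mul, hs, projHom_section, projHom_section, projHom_inclHom]
        simp
      · simp only [inv_mul_cancel_left, map_mul, projHom_section, projHom_inclHom, mul_one,
          fiberCoord_inclHom]
    · intro x _
      beta_reduce
      rw [inclHom_fiberCoord, hqs, mul_inv_cancel_left, mul_inv_cancel_left]
      rw [map_mul, map_inv, projHom_section, inv_mul_cancel]
    · intro g _ n n'
      simp only [map_mul, mul_assoc]

theorem extension_correspondsTo : (extension hS hω).CorrespondsTo A.S := by
  refine ⟨canonicalSection hS hω, A.S, ⟨⟨rfl, _, isOpen_baseNhd hω, one_mem_baseNhd hω,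
    mSmoothOn_section hS hω⟩, projHom_section hS hω⟩, fun g n => ?_,
    1, ⟨rfl, (mSmoothOn_const 1 _).locallySmooth⟩, fun g => by simp⟩
  exact eq_mul_inv_of_mul_eq (section_mul_inclHom hS hω g n).symm

end FactorSystem

end CrossedProductExtension

/-! ### The factor set of an extension. -/

section FactorSetOfExtension

variable {𝕜 : Type*} [RCLike 𝕜]
  {E : Type*} [AddCommGroup E] [Module 𝕜 E] [TopologicalSpace E] [IsTopologicalAddGroup E]
  [ContinuousSMul 𝕜 E] [PolynormableSpace 𝕜 E] [T2Space E]
  {F : Type*} [AddCommGroup F] [Module 𝕜 F] [TopologicalSpace F] [IsTopologicalAddGroup F]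
  [ContinuousSMul 𝕜 F] [PolynormableSpace 𝕜 F] [T2Space F]
  {G : Type*} [Group G] [TopologicalSpace G] [ChartedSpace E G] [IsLieGroup 𝕜 E G]
  {N : Type*} [Group N] [TopologicalSpace N] [ChartedSpace F N] [IsLieGroup 𝕜 F N]

namespace LieGroupExtension

variable (X : LieGroupExtension 𝕜 E F G N)

/-- Local triviality over 1 provides a smooth left inverse of ι, so smoothness of an N-valued map
can be tested in the total group. -/
theorem locallySmooth_of_ι_comp {E' : Type*} [AddCommGroup E'] [Module 𝕜 E']
    [TopologicalSpace E'] [IsTopologicalAddGroup E'] [ContinuousSMul 𝕜 E'] {M : Type*} [One M]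
    [TopologicalSpace M] [ChartedSpace E' M] {f : M → N}
    (h : LocallySmooth 𝕜 E' X.Model (fun x => X.ι (f x))) : LocallySmooth 𝕜 E' F f := by
  obtain ⟨O, hO, h1, hf⟩ := h
  obtain ⟨U, hU, hU1, Φ, Ψ, -, hΨ, hΦΨ, -, hι⟩ := X.locallyTrivial 1
  have hqU : IsOpen (X.q ⁻¹' U) := by
    simpa using X.q_smooth.1.isOpen_inter_preimage isOpen_univ hU
  -- Φ need not send (1, 1) to 1; multiplying by Φ(1, 1) makes Ψ return n from ι(n).
  have hΦ1 : ∀ n, Φ (1, 1) * X.ι n = Φ (1, n) := fun n => by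
    rw [← hι 1 hU1, one_mul]
  refine ⟨O, hO, h1, (hΨ.comp ((mSmoothOn_const (Φ (1, 1)) O).mul hf hO) hO hqU
    fun x _ => ?_).congr hO fun x _ => ?_⟩
  · rw [mem_preimage, hΦ1, (hΦΨ 1 hU1 _).1]
    exact hU1
  · rw [Function.comp, hΦ1, (hΦΨ 1 hU1 _).2]

/-- An extension corresponding to `[S]` provides a factor set for `S` with trivial coboundary. -/
theorem exists_factorSet {S : G → MulAut N} (hX : X.CorrespondsTo S) : ∃ ω : G → G → N,
    IsC2ss 𝕜 E F ω ∧ (∀ g g', deltaMap S g g' = MulAut.conj (ω g g')) ∧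
      ∀ a b c, dCochain S ω a b c = 1 := by
  obtain ⟨σ, S', ⟨⟨hσ1, hσs⟩, hσq⟩, hσ, h, ⟨hh1, hhs⟩, hSS⟩ := hX
  -- Conjugation by σ(g) induces C_N(h(g)) S(g); dividing by h(g) leaves exactly S(g).
  set τ : G → X.Total := fun g => (X.ι (h g))⁻¹ * σ g with hτ
  have hqι : ∀ n, X.q (X.ι n) = 1 := fun n => by
    rw [← MonoidHom.mem_ker, ← X.range_ι]
    exact ⟨n, rfl⟩
  have hτ1 : τ 1 = 1 := by simp [hτ, hσ1, hh1]
  have hτs : LocallySmooth 𝕜 E X.Model τ := (X.ι_smooth.locallySmooth_comp hhs).inv.mul hσs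
  have hτq : ∀ g, X.q (τ g) = g := fun g => by simp [hτ, hqι, hσq]
  have hτS : ∀ g n, X.ι (S g n) = τ g * X.ι n * (τ g)⁻¹ := fun g n => by
    have e := hσ g n
    rw [hSS] at e
    simp only [MulAut.mul_apply, MulAut.conj_apply, map_mul, map_inv] at e
    calc X.ι (S g n)
        = (X.ι (h g))⁻¹ * (X.ι (h g) * X.ι (S g n) * (X.ι (h g))⁻¹) * X.ι (h g) := by group
      _ = τ g * X.ι n * (τ g)⁻¹ := by
        rw [e, hτ]
        group
  have hω : ∀ g g', ∃ n, X.ι n = τ g * τ g' * (τ (g * g'))⁻¹ := fun g g' => by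
    rw [← MonoidHom.mem_range, X.range_ι, MonoidHom.mem_ker]
    simp [hτq]
  choose ω hω using hω
  refine ⟨ω, ⟨⟨fun g => X.ι_injective ?_, fun g => X.ι_injective ?_, ?_⟩, fun g => ?_⟩,
    fun g g' => ?_, fun a b c => X.ι_injective ?_⟩
  · simp [hω, hτ1]
  · simp [hω, hτ1]
  · apply X.locallySmooth_of_ι_comp
    simp only [hω]
    have h1 : LocallySmooth 𝕜 (E × E) E (fun p : G × G => p.1) :=
      (mSmoothOn_fst univ).locallySmooth
    have h2 : LocallySmooth 𝕜 (E × E) E (fun p : G × G => p.2) :=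
      (mSmoothOn_snd univ).locallySmooth
    exact ((hτs.comp h1 rfl).mul (hτs.comp h2 rfl)).mul (hτs.comp (h1.mul h2) (mul_one 1)).inv
  · apply X.locallySmooth_of_ι_comp
    -- The factors τ(gx) cancel. What remains contains τ only at the constant g and at points near
    -- 1, so no smoothness of τ away from 1 is needed.
    have e : ∀ x, X.ι (ω g x * (ω (g * x * g⁻¹) g)⁻¹) =
        τ g * τ x * (τ g)⁻¹ * (τ (g * x * g⁻¹))⁻¹ := fun x => by
      simp only [map_mul, map_inv, hω, inv_mul_cancel_right]
      group
    simp only [e]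
    have hc : LocallySmooth 𝕜 E E (fun x : G => g * x * g⁻¹) :=
      ((locallySmooth_const g).mul (locallySmooth_id 𝕜 E G)).mul (locallySmooth_const g⁻¹)
    exact (((locallySmooth_const (τ g)).mul hτs).mul (locallySmooth_const (τ g)⁻¹)).mul
      (hτs.comp hc (by simp)).inv
  · rw [deltaMap, mul_inv_eq_iff_eq_mul]
    ext n
    apply X.ι_injective
    simp only [MulAut.mul_apply, MulAut.conj_apply, map_mul, map_inv, hτS, hω]
    group
  · simp only [dCochain, map_mul, map_inv, hτS, hω, map_one, mul_assoc a b c]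
    group

end LieGroupExtension

end FactorSetOfExtension

/-! ### Vanishing of the characteristic class. -/

section CharacteristicClass

open scoped IsMulCommutative

variable {𝕜 : Type*} [RCLike 𝕜]
  {E : Type*} [AddCommGroup E] [Module 𝕜 E] [TopologicalSpace E] [IsTopologicalAddGroup E]
  [ContinuousSMul 𝕜 E] [PolynormableSpace 𝕜 E] [T2Space E]
  {F : Type*} [AddCommGroup F] [Module 𝕜 F] [TopologicalSpace F] [IsTopologicalAddGroup F]
  [ContinuousSMul 𝕜 F] [PolynormableSpace 𝕜 F] [T2Space F]
  {G : Type*} [Group G] [TopologicalSpace G] [ChartedSpace E G] [IsLieGroup 𝕜 E G]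
  {N : Type*} [Group N] [TopologicalSpace N] [ChartedSpace F N] [IsLieGroup 𝕜 F N]
  {S : G → MulAut N} {ω : G → G → N} {β : G → G → Subgroup.center N}

theorem IsC2.mul_center (hω : IsC2 𝕜 E F ω) (hβ : β ∈ C₂Center 𝕜 E F G N) :
    IsC2 𝕜 E F fun g g' => ω g g' * β g g' :=
  ⟨fun g => by simpa [hω.one_left] using hβ.one_left g,
    fun g => by simpa [hω.one_right] using hβ.one_right g, hω.locallySmooth.mul hβ.locallySmooth⟩

theorem IsC2ss.mul_center (hω : IsC2ss 𝕜 E F ω) (hβ : β ∈ C₂ssCenter 𝕜 E F G N) :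
    IsC2ss 𝕜 E F fun g g' => ω g g' * β g g' := by
  refine ⟨hω.toIsC2.mul_center hβ.toIsC2, fun g => ?_⟩
  convert (hω.locallySmooth_twist g).mul (hβ.locallySmooth_twist g) using 2 with x
  -- As β is central, the twist of ωβ is the product of the twists of ω and β.
  have hc := Subgroup.mem_center_iff.1 (β g x * (β (g * x * g⁻¹) g)⁻¹).2
    (ω (g * x * g⁻¹) g)⁻¹
  simp only [Subgroup.coe_mul, Subgroup.coe_inv] at hc
  rw [mul_assoc (ω g x) (ω _ g)⁻¹, hc]
  group

theorem deltaMap_eq_conj_mul_center (h : ∀ g g', deltaMap S g g' = MulAut.conj (ω g g'))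
    (g g' : G) : deltaMap S g g' = MulAut.conj (ω g g' * β g g') := by
  rw [h, map_mul]
  ext n
  simp [(Subgroup.mem_center_iff.1 (β g g').2 n).symm]

theorem dCochain_mul_inv_eq_one (h : ∀ g g', deltaMap S g g' = MulAut.conj (ω g g'))
    (hβ : d₂ S β = dCentral h) (a b c : G) :
    dCochain S (fun g g' => ω g g' * β⁻¹ g g') a b c = 1 := by
  have := dCentral_mul (β := β⁻¹) (fun _ _ => rfl) h (deltaMap_eq_conj_mul_center h)
  rw [map_inv, hβ, mul_inv_cancel] at this
  exact congrArg Subtype.val (congrFun (congrFun (congrFun this a) b) c)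

theorem dCentral_eq_one (h : ∀ g g', deltaMap S g g' = MulAut.conj (ω g g'))
    (hd : ∀ a b c, dCochain S ω a b c = 1) : dCentral h = 1 := by
  funext a b c
  exact Subtype.ext (hd a b c)

/-- If the chosen lift has coboundary d_S β, dividing it by β makes the coboundary trivial.
Conversely, the class may be computed from any lift, in particular from one with trivial coboundary.
-/
theorem charClassSs_eq_one_iff (hS : IsStronglySmoothOuterAction 𝕜 E F S) :
    charClassSs hS = 1 ↔ ∃ ω : G → G → N, IsC2ss 𝕜 E F ω ∧
      (∀ g g', deltaMap S g g' = MulAut.conj (ω g g')) ∧ ∀ a b c, dCochain S ω a b c = 1 := by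
  constructor
  · intro h
    obtain ⟨hω, hd⟩ := hS.exists_lift.choose_spec
    obtain ⟨β, hβ, hb⟩ := (QuotientGroup.eq_one_iff _).1 h
    exact ⟨_, hω.mul_center (inv_mem hβ), deltaMap_eq_conj_mul_center hd,
      dCochain_mul_inv_eq_one hd hb⟩
  · rintro ⟨ω, hω, h, hd⟩
    refine (charClassSsOf_eq hS.isC1Aut _ _ hω h).trans ((QuotientGroup.eq_one_iff _).2 ?_)
    exact ⟨1, one_mem _, (map_one _).trans (dCentral_eq_one h hd).symm⟩

theorem charClassS_eq_one_iff (hS : IsSmoothOuterAction 𝕜 E F S) :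
    charClassS hS = 1 ↔ ∃ ω : G → G → N, IsC2 𝕜 E F ω ∧
      (∀ g g', deltaMap S g g' = MulAut.conj (ω g g')) ∧ ∀ a b c, dCochain S ω a b c = 1 := by
  constructor
  · intro h
    obtain ⟨hω, hd⟩ := hS.exists_lift.choose_spec
    obtain ⟨β, hβ, hb⟩ := (QuotientGroup.eq_one_iff _).1 h
    exact ⟨_, hω.mul_center (inv_mem hβ), deltaMap_eq_conj_mul_center hd,
      dCochain_mul_inv_eq_one hd hb⟩
  · rintro ⟨ω, hω, h, hd⟩
    refine (charClassSOf_eq hS.isC1Aut _ _ hω h).trans ((QuotientGroup.eq_one_iff _).2 ?_)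
    exact ⟨1, one_mem _, (map_one _).trans (dCentral_eq_one h hd).symm⟩

/-- The factor system formed by `S` and a normalized `ω` with `δ_S = C_N ∘ ω` and `d_S ω = 1`. -/
def IsC2.factorSystem (hS : IsC1Aut 𝕜 E F S) (hω : IsC2 𝕜 E F ω)
    (h : ∀ g g', deltaMap S g g' = MulAut.conj (ω g g'))
    (hd : ∀ a b c, dCochain S ω a b c = 1) : FactorSystem G N :=
  ⟨S, ω, hS.map_one, hω.one_left, hω.one_right, h, hd⟩

/-- There is an extension corresponding to `[S]` exactly when some factor set for `S` in `C²_ss`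
has trivial coboundary. -/
theorem extKernel_nonempty_iff (hS : IsC1Aut 𝕜 E F S) :
    (ExtKernel 𝕜 E F S).Nonempty ↔ ∃ ω : G → G → N, IsC2ss 𝕜 E F ω ∧
      (∀ g g', deltaMap S g g' = MulAut.conj (ω g g')) ∧ ∀ a b c, dCochain S ω a b c = 1 := by
  constructor
  · rintro ⟨_, X, -, hX⟩
    exact X.exists_factorSet hX
  · rintro ⟨ω, hω, h, hd⟩
    exact ⟨_, FactorSystem.extension (A := hω.toIsC2.factorSystem hS h hd) hS hω, rfl,
      FactorSystem.extension_correspondsTo _ _⟩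

end CharacteristicClass

theorem mainTheorem1 {𝕜 : Type*} [RCLike 𝕜]
    {E : Type*} [AddCommGroup E] [Module 𝕜 E] [TopologicalSpace E] [IsTopologicalAddGroup E]
    [ContinuousSMul 𝕜 E] [PolynormableSpace 𝕜 E] [T2Space E]
    {F : Type*} [AddCommGroup F] [Module 𝕜 F] [TopologicalSpace F] [IsTopologicalAddGroup F]
    [ContinuousSMul 𝕜 F] [PolynormableSpace 𝕜 F] [T2Space F]
    {G : Type*} [Group G] [TopologicalSpace G] [ChartedSpace E G] [IsLieGroup 𝕜 E G]
    {N : Type*} [Group N] [TopologicalSpace N] [ChartedSpace F N] [IsLieGroup 𝕜 F N] :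
    (∀ (S : G → MulAut N) (hS : IsStronglySmoothOuterAction 𝕜 E F S),
      charClassSs hS = 1 ↔ (ExtKernel 𝕜 E F S).Nonempty) ∧
    (ConnectedSpace G → ∀ (S : G → MulAut N) (hS : IsSmoothOuterAction 𝕜 E F S),
      charClassS hS = 1 ↔ (ExtKernel 𝕜 E F S).Nonempty) := by
  refine ⟨fun S hS => ?_, fun _ S hS => ?_⟩
  · rw [charClassSs_eq_one_iff, extKernel_nonempty_iff hS.isC1Aut]
  · rw [charClassS_eq_one_iff, extKernel_nonempty_iff hS.isC1Aut]
    constructor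
    -- The coboundary must be trivial before connectedness is used: the open subgroup argument takes
    -- place in the crossed product group, which requires d_S ω = 1.
    · rintro ⟨ω, hω, h, hd⟩
      exact ⟨ω, FactorSystem.isC2ss_of_connected (A := hω.factorSystem hS.isC1Aut h hd)
        hS.isC1Aut hω, h, hd⟩
    · rintro ⟨ω, hω, h⟩
      exact ⟨ω, hω.toIsC2, h⟩
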